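/- **Setting.** Fix a Grothendieck universe of *small* sets (the sets of cardinality below a fixed inaccessible cardinal $\kappa$), a category $\mathbb C$ that is a set (not necessarily small in this sense), and let $\mathcal E=[\mathbb C^{op},\mathbf{Set}]$. A map $p:A\to X$ in $\mathcal E$ is a *small map* if for all $c\in\mathbb C$ and $x\in X(c)$ the set of lifts $\{a\in A(c)\mid p(a)=x\}$ is small. Let $\pi:E\to U$ be the small map classifier: $U(c)$ is the set of presheaves of small sets on $\mathbb C/c$, $E(c)$ the set of presheaves of pointed small sets on $\mathbb C/c$, and $\pi$ forgets the points. For $\alpha:X\to U$ let $p_\alpha:X.\alpha\to X$ be the pullback of $\pi$ along $\alpha$. The *characteristic map* $X\to U$ of a small map $p:A\to X$ sends $x\in X(c)$ to the presheaf $(f:d\to c)\mapsto\{a\in A(d)\mid p(a)=x.f\}$ on $\mathbb C/c$; there is an evident map $A\to E$ over it, sending $a\in A(c)$ to the presheaf at $p(a)$ pointed by the restrictions of $a$. Let $\mathsf{Cof}$ be a class of cofibrations in $\mathcal E$: a class of monomorphisms that contains $0\to1$ and $\mathrm{id}_1$, is stable under pullback and closed under composition, and such that the category of cofibrations and pullback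 squares has a terminal object. Let $I$ be an interval with connections: an object with maps $\delta^0\neq\delta^1:1\to I$, which are cofibrations, and $c_0,c_1:I\times I\to I$ such that $c_k(\delta^k,i)=\delta^k=c_k(i,\delta^k)$ and $c_k(\delta^{1-k},i)=i=c_k(i,\delta^{1-k})$ for $k=0,1$. A *uniform fibration structure* on $p:A\to X$ is a function $j$ that assigns to every cofibration $m:S\to T$, every $k\in\{0,1\}$ and every commutative square $(u,v)$ from the pushout-product $m\otimes\delta^k:T+_S(S\times I)\to T\times I$ to $p$ a diagonal filler $j(m,u,v):T\times I\to A$, such that for every $t:T'\to T$ and every pullback $m'$ of $m$ along $t$ the filler chosen for $m'$ and the restricted square is $j(m,u,v)\circ(t\times I)$. A *small uniform fibration* is a small map with a uniform fibration structure. A pullback square from $p:A\to X$ to $p':B\to Y$ carries each structure $j'$ on $p'$ to a structure on $p$, the *pulled back* structure: its filler for $(m,u,v)$ is the one over $v$ whose composite with $A\to B$ is the filler that $j'$ chooses for the image of the square. Suppose that $I$ is *tiny*: the path functor $X\mapsto X^I$ has a right adjoint $X\mapsto X_I$ (the root functor), with unit $\eta:X\to(X^I)_I$. For $\alpha:X\to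 U$ let $\mathrm{Fill}(\alpha\circ x)\to X^I$ be the object over $X^I$ that interprets, in the context $x:X^I$, the type $\mathrm{Fill}_0(\alpha\circ x)\times\mathrm{Fill}_1(\alpha\circ x)$, where $$\mathrm{Fill}_k(\alpha\circ x)=\prod_{\varphi:\Phi}\ \prod_{v:[\varphi]\to\prod_{i:I}\alpha(x_i)}\ \prod_{a:\alpha(x_k)}\big(v_k=a\text{ on }\varphi\big)\to\sum_{s:\prod_{i:I}\alpha(x_i)}(s_k=a)\times(s=v\text{ on }\varphi)$$ and $\Phi$ is the object classifying cofibrations, with $x_0,x_1$ the endpoints of $x$. Let $\mathrm{Fib}^*(\alpha)\to X$ be the pullback of $\mathrm{Fill}(\alpha\circ x)_I\to(X^I)_I$ along $\eta:X\to(X^I)_I$. Put $\mathrm{Fib}=\mathrm{Fib}^*(\mathrm{id}_U)=\sum_{\alpha:U}\mathrm{Fib}^*(\alpha)$, with its projection $\mathrm{Fib}\to U$, and let $\mathrm{Fib}^\bullet\to\mathrm{Fib}$ be the pullback of $\pi:E\to U$ along $\mathrm{Fib}\to U$. **Theorem (Universal fibration).** 1. (Stability.) For all $\alpha:X\to U$,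 $\beta:Y\to U$, $t:Y\to X$ and every pullback square from $p_\beta$ to $p_\alpha$ over $t$, the induced square from $\mathrm{Fib}^*(\beta)\to Y$ to $\mathrm{Fib}^*(\alpha)\to X$ over $t$ is a pullback. 2. $\mathrm{Fib}^\bullet\to\mathrm{Fib}$ is a universal small uniform fibration. That is, it is a small map, and it carries a uniform fibration structure $j_{\mathrm{univ}}$ with the following property. Let $p:A\to X$ be a small map with a uniform fibration structure $j$. Then the characteristic map of $p$, with the evident map $A\to E$, exhibits $p$ as a pullback of $\pi$. Moreover, for every pullback square $(q,\alpha)$ from $p$ to $\pi$, with $q:A\to E$ and $\alpha:X\to U$ (in particular for this canonical one), there is exactly one map $\chi:X\to\mathrm{Fib}$ over $\alpha$ for which there is a pullback square from $p$ to $\mathrm{Fib}^\bullet\to\mathrm{Fib}$ over $\chi$ such that $A\to\mathrm{Fib}^\bullet\to E$ is $q$ and $j$ is the structure pulled back from $j_{\mathrm{univ}}$. -/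

import Mathlib

open CategoryTheory Limits Opposite MonoidalCategory CartesianMonoidalCategory

universe w v u

set_option linter.checkUnivs false

noncomputable section

namespace PshFib

section Basic

variable {C : Type u} [SmallCategory.{u} C]

/-- The presheaf topos on a small category `C`. The ambient category of sets is `Type u`. -/
abbrev Psh (C : Type u) [SmallCategory.{u} C] : Type (u + 1) := Cᵒᵖ ⥤ Type u

/-- `p : A ⟶ X` is a small map: for every `x ∈ X(c)` the set of all lifts of `x` across `p` is
a small set. The Grothendieck universe of small sets is `Type w`. -/
def IsSmallMap {A X : Psh C} (p : A ⟶ X) : Prop :=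
  ∀ (c : C) (x : X.obj (op c)), Small.{w} {a : A.obj (op c) // p.app (op c) a = x}

/-! ### Cofibrations and intervals -/

/-- A class of cofibrations in a presheaf topos. -/
structure IsCofibrationClass (W : MorphismProperty (Psh C)) : Prop where
  mono : ∀ {S T : Psh C} (m : S ⟶ T), W m → Mono m
  initial_to_one : W (initial.to (𝟙_ (Psh C)))
  id_one : W (𝟙 (𝟙_ (Psh C)))
  pullback : ∀ {S' S T' T : Psh C} {s : S' ⟶ S} {m' : S' ⟶ T'} {m : S ⟶ T} {t : T' ⟶ T},
    IsPullback s m' m t → W m → W m'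
  comp : ∀ {R S T : Psh C} (m : R ⟶ S) (n : S ⟶ T), W m → W n → W (m ≫ n)
  /-- The category of cofibrations and cartesian squares has a terminal object. -/
  terminal : ∃ (S₀ Φ : Psh C) (τ : S₀ ⟶ Φ), W τ ∧
    ∀ {S T : Psh C} (m : S ⟶ T), W m →
      ∃! q : (S ⟶ S₀) × (T ⟶ Φ), IsPullback q.1 m τ q.2

/-- An interval with connections, relative to a class `W` of cofibrations. -/
structure Interval (W : MorphismProperty (Psh C)) where
  /-- the underlying presheaf -/
  obj : Psh C
  /-- the endpoints `δ⁰, δ¹ : 1 ⟶ I` -/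
  δ : Fin 2 → (𝟙_ (Psh C) ⟶ obj)
  /-- the connections `c₀, c₁ : I × I ⟶ I` -/
  conn : Fin 2 → (obj ⊗ obj ⟶ obj)
  δ_ne : δ 0 ≠ δ 1
  δ_cof : ∀ k, W (δ k)
  /-- `c_k(δᵏ, i) = δᵏ` -/
  conn_left : ∀ k, lift (toUnit obj ≫ δ k) (𝟙 obj) ≫ conn k = toUnit obj ≫ δ k
  /-- `c_k(i, δᵏ) = δᵏ` -/
  conn_right : ∀ k, lift (𝟙 obj) (toUnit obj ≫ δ k) ≫ conn k = toUnit obj ≫ δ k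
  /-- `c_k(δ¹⁻ᵏ, i) = i` -/
  conn_left' : ∀ k, lift (toUnit obj ≫ δ (1 - k)) (𝟙 obj) ≫ conn k = 𝟙 obj
  /-- `c_k(i, δ¹⁻ᵏ) = i` -/
  conn_right' : ∀ k, lift (𝟙 obj) (toUnit obj ≫ δ (1 - k)) ≫ conn k = 𝟙 obj

variable {W : MorphismProperty (Psh C)} (I : Interval W)

namespace Interval

/-- The inclusion `δᵏ × T : T ≅ 1 × T ⟶ I × T` of an end of the cylinder. -/
def atEnd (k : Fin 2) (T : Psh C) : T ⟶ I.obj ⊗ T :=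
  lift (toUnit T ≫ I.δ k) (𝟙 T)

lemma atEnd_naturality (k : Fin 2) {S T : Psh C} (m : S ⟶ T) :
    m ≫ I.atEnd k T = I.atEnd k S ≫ I.obj ◁ m := by
  apply CartesianMonoidalCategory.hom_ext <;> simp [atEnd]

/-! ### Uniform fibrations -/

/-- The domain `T +_S (I × S)` of the pushout-product of `m : S ⟶ T` with `δᵏ`. -/
def ppObj {S T : Psh C} (m : S ⟶ T) (k : Fin 2) : Psh C :=
  pushout m (I.atEnd k S)

/-- The pushout-product `m ⊗ δᵏ : T +_S (I × S) ⟶ I × T`. -/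
def pp {S T : Psh C} (m : S ⟶ T) (k : Fin 2) : I.ppObj m k ⟶ I.obj ⊗ T :=
  pushout.desc (I.atEnd k T) (I.obj ◁ m) (I.atEnd_naturality k m)

/-- The map between the domains of the pushout-products induced by a commutative square. -/
def ppMap {S' S T' T : Psh C} {s : S' ⟶ S} {m' : S' ⟶ T'} {m : S ⟶ T} {t : T' ⟶ T}
    (sq : CommSq s m' m t) (k : Fin 2) : I.ppObj m' k ⟶ I.ppObj m k :=
  pushout.map m' (I.atEnd k S') m (I.atEnd k S) t (I.obj ◁ s) s sq.w.symm
    (I.atEnd_naturality k s).symm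

end Interval

/-- A uniform fibration structure on `p : A ⟶ X`: a choice of diagonal fillers against all
pushout-products `m ⊗ δᵏ` of a cofibration with an endpoint, compatible with pullback. -/
structure UniformFibration {A X : Psh C} (p : A ⟶ X) where
  fill : ∀ {S T : Psh C} (m : S ⟶ T) (_ : W m) (k : Fin 2)
    (a : I.ppObj m k ⟶ A) (x : I.obj ⊗ T ⟶ X), a ≫ p = I.pp m k ≫ x → (I.obj ⊗ T ⟶ A)
  pp_fill : ∀ {S T : Psh C} (m : S ⟶ T) (hm : W m) (k : Fin 2)
    (a : I.ppObj m k ⟶ A) (x : I.obj ⊗ T ⟶ X) (h : a ≫ p = I.pp m k ≫ x),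
    I.pp m k ≫ fill m hm k a x h = a
  fill_proj : ∀ {S T : Psh C} (m : S ⟶ T) (hm : W m) (k : Fin 2)
    (a : I.ppObj m k ⟶ A) (x : I.obj ⊗ T ⟶ X) (h : a ≫ p = I.pp m k ≫ x),
    fill m hm k a x h ≫ p = x
  uniform : ∀ {S' S T' T : Psh C} {s : S' ⟶ S} {m' : S' ⟶ T'} {m : S ⟶ T} {t : T' ⟶ T}
    (sq : IsPullback s m' m t) (hm' : W m') (hm : W m) (k : Fin 2)
    (a : I.ppObj m k ⟶ A) (x : I.obj ⊗ T ⟶ X) (h : a ≫ p = I.pp m k ≫ x)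
    (h' : (I.ppMap sq.toCommSq k ≫ a) ≫ p = I.pp m' k ≫ I.obj ◁ t ≫ x),
    fill m' hm' k (I.ppMap sq.toCommSq k ≫ a) (I.obj ◁ t ≫ x) h' =
      I.obj ◁ t ≫ fill m hm k a x h

/-- The square formed by `q : A ⟶ B` over `t : X ⟶ Y` carries the chosen fillers of `j` to the
chosen fillers of `j'`. If the square is a pullback, this says that `j` is the structure obtained
from `j'` by pullback along `t`. -/
def UniformFibration.Preserved {A X B Y : Psh C} {p : A ⟶ X} {p' : B ⟶ Y}
    (j : UniformFibration I p) (j' : UniformFibration I p') (q : A ⟶ B) (t : X ⟶ Y) : Prop :=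
  ∀ {S T : Psh C} (m : S ⟶ T) (hm : W m) (k : Fin 2) (a : I.ppObj m k ⟶ A)
    (x : I.obj ⊗ T ⟶ X) (h : a ≫ p = I.pp m k ≫ x)
    (h' : (a ≫ q) ≫ p' = I.pp m k ≫ x ≫ t),
    j'.fill m hm k (a ≫ q) (x ≫ t) h' = j.fill m hm k a x h ≫ q

/-! ### The family of filling structures over the path object -/

/-- The path object `X^I`. -/
abbrev pathObj (X : Psh C) : Psh C := (ihom I.obj).obj X

/-- An element `x ∈ X^I(c)`, regarded as a map `I × yc ⟶ X`. -/
def pathMap {X : Psh C} {c : C} (x : (pathObj I X).obj (op c)) : I.obj ⊗ yoneda.obj c ⟶ X :=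
  MonoidalClosed.uncurry (yonedaEquiv.symm x)

lemma pathMap_map {X : Psh C} {c d : C} (g : d ⟶ c) (x : (pathObj I X).obj (op c)) :
    pathMap I ((pathObj I X).map g.op x) = I.obj ◁ yoneda.map g ≫ pathMap I x := by
  rw [pathMap, ← yonedaEquiv_symm_naturality_left, MonoidalClosed.uncurry_natural_left]
  rfl

lemma pathMap_comp {X Y : Psh C} {c : C} (t : X ⟶ Y) (x : (pathObj I X).obj (op c)) :
    pathMap I (((ihom I.obj).map t).app (op c) x) = pathMap I x ≫ t := by
  rw [pathMap, ← yonedaEquiv_symm_naturality_right, MonoidalClosed.uncurry_natural_right]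
  rfl

/-- The map between the subobjects of `yd'` and `yd` determined by `g⁻¹φ` and `φ`. -/
def sieveMap {d d' : C} (g : d' ⟶ d) (φ : Sieve d) : (φ.pullback g).functor ⟶ φ.functor where
  app _ := ↾fun h => ⟨h.1 ≫ g, h.2⟩
  naturality _ _ _ := by
    ext h
    exact Subtype.ext (Category.assoc _ _ _)

lemma sieveMap_incl {d d' : C} (g : d' ⟶ d) (φ : Sieve d) :
    sieveMap g φ ≫ φ.functorInclusion = (φ.pullback g).functorInclusion ≫ yoneda.map g := rfl

/-- The data of a `k`-directed filling problem over a path `y : I × yd ⟶ X` at stage `d`: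
a cofibrant proposition `φ ∈ Φ(d)`, i.e. a sieve whose inclusion into `yd` is a cofibration;
a partial section `v : [φ] → Π_{i : I} α(y i)`; and `a : α(y k)` such that `v k = a` on `φ`. -/
structure IsFillProblem {A X : Psh C} (p : A ⟶ X) (k : Fin 2) {d : C}
    (y : I.obj ⊗ yoneda.obj d ⟶ X) (φ : Sieve d) (v : I.obj ⊗ φ.functor ⟶ A)
    (a : yoneda.obj d ⟶ A) : Prop where
  cof : W φ.functorInclusion
  v_over : v ≫ p = I.obj ◁ φ.functorInclusion ≫ y
  a_over : a ≫ p = I.atEnd k (yoneda.obj d) ≫ y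
  compat : I.atEnd k φ.functor ≫ v = φ.functorInclusion ≫ a

lemma IsFillProblem.congr {A X : Psh C} {p : A ⟶ X} {k : Fin 2} {d : C}
    {y y' : I.obj ⊗ yoneda.obj d ⟶ X} {φ : Sieve d} {v : I.obj ⊗ φ.functor ⟶ A}
    {a : yoneda.obj d ⟶ A} (h : IsFillProblem I p k y φ v a) (e : y = y') :
    IsFillProblem I p k y' φ v a := e ▸ h

lemma IsFillProblem.comp {A X B Y : Psh C} {p : A ⟶ X} {p' : B ⟶ Y} {q : A ⟶ B} {t : X ⟶ Y}
    (w : q ≫ p' = p ≫ t) {k : Fin 2} {d : C} {y : I.obj ⊗ yoneda.obj d ⟶ X} {φ : Sieve d}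
    {v : I.obj ⊗ φ.functor ⟶ A} {a : yoneda.obj d ⟶ A} (h : IsFillProblem I p k y φ v a) :
    IsFillProblem I p' k (y ≫ t) φ (v ≫ q) (a ≫ q) where
  cof := h.cof
  v_over := by rw [Category.assoc, w, reassoc_of% h.v_over]
  a_over := by rw [Category.assoc, w, reassoc_of% h.a_over]
  compat := by rw [reassoc_of% h.compat]

/-- A generalised element at stage `c` of `Fill(α ∘ x) = Fill₀(α ∘ x) × Fill₁(α ∘ x)` over the
context `x : X^I`, where `α` is the family of fibres of `p : A ⟶ X`, and
`Fill_k(α ∘ x) = Π φ : Φ, Π v : [φ] → Π i, α (x i), Π a : α (x k), (v k = a on φ) →`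
`Σ s : Π i, α (x i), (s k = a) × (s = v on φ)`.
It consists of a path `x ∈ X^I(c)` and of a section `s` for every filling problem over the
restriction of `x` along any `f : d ⟶ c`, naturally in `d`. -/
structure FillElt {A X : Psh C} (p : A ⟶ X) (c : C) where
  path : (pathObj I X).obj (op c)
  fill : ∀ {d : C} (f : d ⟶ c) (k : Fin 2) (φ : Sieve d) (v : I.obj ⊗ φ.functor ⟶ A)
    (a : yoneda.obj d ⟶ A), IsFillProblem I p k (I.obj ◁ yoneda.map f ≫ pathMap I path) φ v a →
    (I.obj ⊗ yoneda.obj d ⟶ A)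
  fill_over : ∀ {d : C} (f : d ⟶ c) (k : Fin 2) (φ : Sieve d) (v : I.obj ⊗ φ.functor ⟶ A)
    (a : yoneda.obj d ⟶ A)
    (h : IsFillProblem I p k (I.obj ◁ yoneda.map f ≫ pathMap I path) φ v a),
    fill f k φ v a h ≫ p = I.obj ◁ yoneda.map f ≫ pathMap I path
  endpoint : ∀ {d : C} (f : d ⟶ c) (k : Fin 2) (φ : Sieve d) (v : I.obj ⊗ φ.functor ⟶ A)
    (a : yoneda.obj d ⟶ A)
    (h : IsFillProblem I p k (I.obj ◁ yoneda.map f ≫ pathMap I path) φ v a),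
    I.atEnd k (yoneda.obj d) ≫ fill f k φ v a h = a
  extends_partial : ∀ {d : C} (f : d ⟶ c) (k : Fin 2) (φ : Sieve d)
    (v : I.obj ⊗ φ.functor ⟶ A) (a : yoneda.obj d ⟶ A)
    (h : IsFillProblem I p k (I.obj ◁ yoneda.map f ≫ pathMap I path) φ v a),
    I.obj ◁ φ.functorInclusion ≫ fill f k φ v a h = v
  natural : ∀ {d e : C} (f : d ⟶ c) (g : e ⟶ d) (k : Fin 2) (φ : Sieve d)
    (v : I.obj ⊗ φ.functor ⟶ A) (a : yoneda.obj d ⟶ A)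
    (h : IsFillProblem I p k (I.obj ◁ yoneda.map f ≫ pathMap I path) φ v a)
    (h' : IsFillProblem I p k (I.obj ◁ yoneda.map (g ≫ f) ≫ pathMap I path) (φ.pullback g)
      (I.obj ◁ sieveMap g φ ≫ v) (yoneda.map g ≫ a)),
    fill (g ≫ f) k (φ.pullback g) (I.obj ◁ sieveMap g φ ≫ v) (yoneda.map g ≫ a) h' =
      I.obj ◁ yoneda.map g ≫ fill f k φ v a h

lemma FillElt.ext' {A X : Psh C} {p : A ⟶ X} {c : C} {x y : FillElt I p c}
    (h : x.path = y.path)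
    (h' : ∀ {d : C} (f : d ⟶ c) (k : Fin 2) (φ : Sieve d) (v : I.obj ⊗ φ.functor ⟶ A)
      (a : yoneda.obj d ⟶ A) (h₁ h₂), x.fill f k φ v a h₁ = y.fill f k φ v a h₂) : x = y := by
  obtain ⟨xp, xf, _, _, _, _⟩ := x
  obtain ⟨yp, yf, _, _, _, _⟩ := y
  obtain rfl : xp = yp := h
  obtain rfl : @xf = @yf := by
    funext d f k φ v a hh
    exact h' f k φ v a hh hh
  rfl

lemma FillElt.fill_congr {A X : Psh C} {p : A ⟶ X} {c : C} (x : FillElt I p c) {d : C}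
    {f f' : d ⟶ c} (ef : f = f') {k : Fin 2} {φ : Sieve d} {v v' : I.obj ⊗ φ.functor ⟶ A}
    (ev : v = v') {a a' : yoneda.obj d ⟶ A} (ea : a = a') (h) (h') :
    x.fill f k φ v a h = x.fill f' k φ v' a' h' := by
  subst ef ev ea; rfl

lemma path_restrict {X : Psh C} {c c' d : C} (g : c' ⟶ c) (f : d ⟶ c')
    (x : (pathObj I X).obj (op c)) :
    I.obj ◁ yoneda.map f ≫ pathMap I ((pathObj I X).map g.op x) =
      I.obj ◁ yoneda.map (f ≫ g) ≫ pathMap I x := by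
  rw [pathMap_map, Functor.map_comp, MonoidalCategory.whiskerLeft_comp_assoc]

/-- Restriction of filling structures along `g : c' ⟶ c`. -/
def FillElt.restrict {A X : Psh C} {p : A ⟶ X} {c c' : C} (g : c' ⟶ c) (x : FillElt I p c) :
    FillElt I p c' where
  path := (pathObj I X).map g.op x.path
  fill f k φ v a h := x.fill (f ≫ g) k φ v a (h.congr I (path_restrict I g f x.path))
  fill_over f k φ v a h := by rw [x.fill_over, path_restrict]
  endpoint f k φ v a h := x.endpoint _ _ _ _ _ _
  extends_partial f k φ v a h := x.extends_partial _ _ _ _ _ _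
  natural f g' k φ v a h h' := by
    rw [x.fill_congr I (Category.assoc g' f g) rfl rfl _
      (h'.congr I (by rw [path_restrict, Category.assoc]))]
    exact x.natural _ _ _ _ _ _ _ _

/-- The object `Fill(α ∘ x)` over `X^I`, where `α` is the family of fibres of `p : A ⟶ X`. -/
def fillObj {A X : Psh C} (p : A ⟶ X) : Psh C where
  obj c := FillElt I p c.unop
  map g := ↾FillElt.restrict I g.unop
  map_id c := by
    ext x
    exact FillElt.ext' I (by simp [FillElt.restrict])
      (fun f k φ v a h₁ h₂ => x.fill_congr I (Category.comp_id f) rfl rfl _ _)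
  map_comp g g' := by
    ext x
    exact FillElt.ext' I (by simp [FillElt.restrict])
      (fun f k φ v a h₁ h₂ => x.fill_congr I (Category.assoc f _ _).symm rfl rfl _ _)

/-- The projection `Fill(α ∘ x) ⟶ X^I`. -/
def fillProj {A X : Psh C} (p : A ⟶ X) : fillObj I p ⟶ pathObj I X where
  app _ := ↾fun x => x.path
  naturality _ _ _ := rfl

lemma path_push {X Y : Psh C} (t : Y ⟶ X) {c d : C} (f : d ⟶ c)
    (y : (pathObj I Y).obj (op c)) :
    I.obj ◁ yoneda.map f ≫ pathMap I (((ihom I.obj).map t).app (op c) y) =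
      (I.obj ◁ yoneda.map f ≫ pathMap I y) ≫ t := by
  rw [pathMap_comp, Category.assoc]

section Pullback

variable {A X B Y : Psh C} {p : A ⟶ X} {p' : B ⟶ Y} {q : B ⟶ A} {t : Y ⟶ X}
  (sq : IsPullback q p' p t) {k : Fin 2} {d : C} {y : I.obj ⊗ yoneda.obj d ⟶ Y} {φ : Sieve d}
  {v : I.obj ⊗ φ.functor ⟶ A} {a : yoneda.obj d ⟶ A}
  (h : IsFillProblem I p k (y ≫ t) φ v a)

/-- The partial section of the pulled back family determined by `v`. -/
def liftV : I.obj ⊗ φ.functor ⟶ B :=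
  sq.lift v (I.obj ◁ φ.functorInclusion ≫ y) (by rw [h.v_over, Category.assoc])

/-- The element of the pulled back family determined by `a`. -/
def liftA : yoneda.obj d ⟶ B :=
  sq.lift a (I.atEnd k (yoneda.obj d) ≫ y) (by rw [h.a_over, Category.assoc])

@[simp] lemma liftV_fst : liftV I sq h ≫ q = v := sq.lift_fst _ _ _

@[simp] lemma liftV_snd : liftV I sq h ≫ p' = I.obj ◁ φ.functorInclusion ≫ y :=
  sq.lift_snd _ _ _

@[simp] lemma liftA_fst : liftA I sq h ≫ q = a := sq.lift_fst _ _ _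

@[simp] lemma liftA_snd : liftA I sq h ≫ p' = I.atEnd k (yoneda.obj d) ≫ y :=
  sq.lift_snd _ _ _

lemma isFillProblem_lift : IsFillProblem I p' k y φ (liftV I sq h) (liftA I sq h) where
  cof := h.cof
  v_over := by simp
  a_over := by simp
  compat := by
    apply sq.hom_ext
    · simpa using h.compat
    · simp only [Category.assoc, liftV_snd, liftA_snd]
      rw [← reassoc_of% (I.atEnd_naturality k φ.functorInclusion)]

end Pullback

/-- Given a pullback square exhibiting `p' : B ⟶ Y` as a pullback of `p : A ⟶ X` along
`t : Y ⟶ X`, a filling structure for `p'` over a path `y` in `Y` induces one for `p` over the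
path `t ∘ y` in `X`. -/
def FillElt.push {A X B Y : Psh C} {p : A ⟶ X} {p' : B ⟶ Y} {q : B ⟶ A} {t : Y ⟶ X}
    (sq : IsPullback q p' p t) {c : C} (x : FillElt I p' c) : FillElt I p c where
  path := ((ihom I.obj).map t).app (op c) x.path
  fill f k φ v a h := x.fill f k φ (liftV I sq (h.congr I (path_push I t f x.path)))
    (liftA I sq (h.congr I (path_push I t f x.path))) (isFillProblem_lift I sq _) ≫ q
  fill_over f k φ v a h := by
    rw [Category.assoc, sq.w, reassoc_of% (x.fill_over f k φ _ _ _), path_push, Category.assoc]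
  endpoint f k φ v a h := by
    rw [reassoc_of% (x.endpoint f k φ _ _ _), liftA_fst]
  extends_partial f k φ v a h := by
    rw [reassoc_of% (x.extends_partial f k φ _ _ _), liftV_fst]
  natural {d e} f g k φ v a h h' := by
    have e₁ : liftV I sq (h'.congr I (path_push I t (g ≫ f) x.path)) =
        I.obj ◁ sieveMap g φ ≫ liftV I sq (h.congr I (path_push I t f x.path)) := by
      apply sq.hom_ext
      · simp
      · simp only [Category.assoc, liftV_snd, Functor.map_comp,
          MonoidalCategory.whiskerLeft_comp]
        simp only [← MonoidalCategory.whiskerLeft_comp_assoc]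
        rw [reassoc_of% (sieveMap_incl g φ)]
    have e₂ : liftA I sq (h'.congr I (path_push I t (g ≫ f) x.path)) =
        yoneda.map g ≫ liftA I sq (h.congr I (path_push I t f x.path)) := by
      apply sq.hom_ext
      · simp
      · simp only [Category.assoc, liftA_snd, Functor.map_comp,
          MonoidalCategory.whiskerLeft_comp]
        rw [reassoc_of% (I.atEnd_naturality k (yoneda.map g))]
    have h₁ := isFillProblem_lift I sq (h'.congr I (path_push I t (g ≫ f) x.path))
    rw [x.fill_congr I rfl e₁ e₂ _ (by rw [← e₁, ← e₂]; exact h₁), x.natural f g, Category.assoc]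

/-- The canonical map `Fill(p') ⟶ Fill(p)` over `t^I : Y^I ⟶ X^I` induced by a pullback square
from `p'` to `p` over `t : Y ⟶ X`. -/
def fillMap {A X B Y : Psh C} {p : A ⟶ X} {p' : B ⟶ Y} {q : B ⟶ A} {t : Y ⟶ X}
    (sq : IsPullback q p' p t) : fillObj I p' ⟶ fillObj I p where
  app c := ↾fun x => FillElt.push I sq x
  naturality c c' g := by
    ext x
    refine FillElt.ext' I ?_ ?_
    · exact ConcreteCategory.congr_hom (((ihom I.obj).map t).naturality g) x.path
    · intro d f k φ v a h₁ h₂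
      refine congrArg (· ≫ q) (x.fill_congr I rfl (sq.hom_ext ?_ ?_) (sq.hom_ext ?_ ?_) _ _)
      · exact (liftV_fst I sq _).trans (liftV_fst I sq _).symm
      · refine (liftV_snd I sq _).trans (Eq.trans ?_ (liftV_snd I sq _).symm)
        exact congrArg _ (path_restrict I g.unop f x.path)
      · exact (liftA_fst I sq _).trans (liftA_fst I sq _).symm
      · refine (liftA_snd I sq _).trans (Eq.trans ?_ (liftA_snd I sq _).symm)
        exact congrArg _ (path_restrict I g.unop f x.path)

lemma fillMap_fillProj {A X B Y : Psh C} {p : A ⟶ X} {p' : B ⟶ Y} {q : B ⟶ A} {t : Y ⟶ X}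
    (sq : IsPullback q p' p t) :
    fillMap I sq ≫ fillProj I p = fillProj I p' ≫ (ihom I.obj).map t := rfl

/-! ### The family of fibration structures over the base -/

section Root

variable {R : Psh C ⥤ Psh C} (adj : ihom I.obj ⊣ R)

/-- The object `Fib*(α)` over `X`, where `α` is the family of fibres of `p : A ⟶ X`: the pullback
of the root of `Fill(α ∘ x) ⟶ X^I` along the unit `X ⟶ (X^I)_I`. -/
def fibStarObj {A X : Psh C} (p : A ⟶ X) : Psh C :=
  pullback (adj.unit.app X) (R.map (fillProj I p))

/-- The projection `Fib*(α) ⟶ X`. -/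
def fibStarProj {A X : Psh C} (p : A ⟶ X) : fibStarObj I adj p ⟶ X :=
  pullback.fst _ _

/-- The canonical map `Fib*(p') ⟶ Fib*(p)` over `t : Y ⟶ X` induced by a pullback square from
`p'` to `p` over `t`. -/
def fibStarMap {A X B Y : Psh C} {p : A ⟶ X} {p' : B ⟶ Y} {q : B ⟶ A} {t : Y ⟶ X}
    (sq : IsPullback q p' p t) : fibStarObj I adj p' ⟶ fibStarObj I adj p :=
  pullback.map _ _ _ _ t (R.map (fillMap I sq)) (R.map ((ihom I.obj).map t))
    (adj.unit.naturality t).symm (by rw [← R.map_comp, ← R.map_comp, fillMap_fillProj])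

end Root

end Basic

/-! ### Pointed presheaves and presheaves of lifts -/

section Lifts

variable {C : Type u} [SmallCategory.{u} C]

/-- A presheaf on a category `D` with values in pointed small sets: a presheaf of small sets
with a choice of points preserved by the restriction maps. -/
structure PointedPsh (D : Type u) [Category.{u} D] where
  psh : Dᵒᵖ ⥤ Type w
  point : ∀ d : Dᵒᵖ, psh.obj d
  map_point : ∀ {d d' : Dᵒᵖ} (f : d ⟶ d'), psh.map f (point d) = point d'

/-- Restriction of a pointed presheaf along a functor. -/
def PointedPsh.precomp {D D' : Type u} [Category.{u} D]
    [Category.{u} D'] (F : D' ⥤ D) (β : PointedPsh.{w, u} D) :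
    PointedPsh.{w, u} D' where
  psh := F.op ⋙ β.psh
  point d := β.point (F.op.obj d)
  map_point f := β.map_point (F.op.map f)

lemma PointedPsh.precomp_congr {D D' : Type u} [Category.{u} D]
    [Category.{u} D'] {F G : D' ⥤ D} (h : F = G) (β : PointedPsh.{w, u} D) :
    β.precomp F = β.precomp G := by rw [h]

/-- The presheaf on `C/c` of lifts across `p : A ⟶ X` of a compatible family `z` of elements of
`X`. -/
def liftsPsh {A X : Psh C} (p : A ⟶ X) (hp : IsSmallMap.{w} p) {c : C}
    (z : ∀ f : Over c, X.obj (op f.left))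
    (hz : ∀ {f g : Over c} (h : f ⟶ g), X.map h.left.op (z g) = z f) :
    (Over c)ᵒᵖ ⥤ Type w :=
  haveI (f : Over c) :
    Small.{w} {a : A.obj (op f.left) // p.app (op f.left) a = z f} := hp f.left (z f)
  { obj f := Shrink.{w} {a : A.obj (op f.unop.left) // p.app (op f.unop.left) a = z f.unop}
    map {f g} h := ↾fun a => equivShrink {a // p.app (op g.unop.left) a = z g.unop}
      ⟨A.map h.unop.left.op ((equivShrink _).symm a).1, by
        rw [NatTrans.naturality_apply, ((equivShrink _).symm a).2, hz]⟩
    map_id f := by ext a; simp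
    map_comp f g := by ext a; simp }

lemma liftsPsh_congr {A X : Psh C} (p : A ⟶ X) (hp : IsSmallMap.{w} p) {c : C}
    {z z' : ∀ f : Over c, X.obj (op f.left)} (h : z = z') (hz) (hz') :
    liftsPsh p hp z hz = liftsPsh p hp z' hz' := by
  subst h; rfl

/-- The pointed presheaf of lifts across `p : A ⟶ X` of `z`, where `s` is a compatible family of
such lifts. -/
def liftsPtd {A X : Psh C} (p : A ⟶ X) (hp : IsSmallMap.{w} p) {c : C}
    (z : ∀ f : Over c, X.obj (op f.left))
    (hz : ∀ {f g : Over c} (h : f ⟶ g), X.map h.left.op (z g) = z f)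
    (s : ∀ f : Over c, A.obj (op f.left))
    (hs : ∀ {f g : Over c} (h : f ⟶ g), A.map h.left.op (s g) = s f)
    (hsz : ∀ f, p.app (op f.left) (s f) = z f) :
    PointedPsh.{w, u} (Over c) :=
  haveI (f : Over c) :
    Small.{w} {a : A.obj (op f.left) // p.app (op f.left) a = z f} := hp f.left (z f)
  { psh := liftsPsh p hp z hz
    point f := equivShrink {a // p.app (op f.unop.left) a = z f.unop} ⟨s f.unop, hsz f.unop⟩
    map_point {f g} h := by
      dsimp [liftsPsh]
      refine congrArg _ (Subtype.ext ?_)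
      simpa using hs h.unop }

lemma liftsPtd_congr {A X : Psh C} (p : A ⟶ X) (hp : IsSmallMap.{w} p) {c : C}
    {z z' : ∀ f : Over c, X.obj (op f.left)} (h : z = z') (hz) (hz')
    {s s' : ∀ f : Over c, A.obj (op f.left)} (h' : s = s') (hs) (hs') (hsz) (hsz') :
    liftsPtd p hp z hz s hs hsz = liftsPtd p hp z' hz' s' hs' hsz' := by
  subst h h'; rfl

/-- The family of restrictions of an element `x ∈ X(c)`. -/
def restrictions {X : Psh C} {c : C} (x : X.obj (op c)) (f : Over c) : X.obj (op f.left) :=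
  X.map f.hom.op x

lemma restrictions_map {X : Psh C} {c : C} (x : X.obj (op c)) {f g : Over c} (h : f ⟶ g) :
    X.map h.left.op (restrictions x g) = restrictions x f := by
  rw [restrictions, restrictions, ← Over.w h, op_comp, Functor.map_comp_apply]

lemma restrictions_restrict {X : Psh C} {c c' : C} (g : c' ⟶ c) (x : X.obj (op c)) :
    restrictions (X.map g.op x) = fun f => restrictions x ((Over.map g).obj f) := by
  funext f
  simp [restrictions]

lemma restrictions_app {A X : Psh C} (p : A ⟶ X) {c : C} (a : A.obj (op c)) (f : Over c) :
    p.app (op f.left) (restrictions a f) = restrictions (p.app (op c) a) f :=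
  NatTrans.naturality_apply _ _ _

lemma liftsPsh_restrict {A X : Psh C} (p : A ⟶ X) (hp : IsSmallMap.{w} p) {c c' : C}
    (g : c' ⟶ c) (x : X.obj (op c)) :
    liftsPsh p hp (restrictions (X.map g.op x)) (restrictions_map _) =
      (Over.map g).op ⋙ liftsPsh p hp (restrictions x) (restrictions_map x) :=
  liftsPsh_congr p hp (restrictions_restrict g x) (restrictions_map _)
    (fun h => restrictions_map x ((Over.map g).map h))

lemma liftsPtd_restrict {A X : Psh C} (p : A ⟶ X) (hp : IsSmallMap.{w} p) {c c' : C}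
    (g : c' ⟶ c) (a : A.obj (op c)) :
    liftsPtd p hp (restrictions (p.app (op c') (A.map g.op a))) (restrictions_map _)
      (restrictions (A.map g.op a)) (restrictions_map _) (restrictions_app p _) =
    (liftsPtd p hp (restrictions (p.app (op c) a)) (restrictions_map _)
      (restrictions a) (restrictions_map _) (restrictions_app p a)).precomp (Over.map g) := by
  refine liftsPtd_congr p hp ?_ (restrictions_map _)
    (fun h => restrictions_map (p.app (op c) a) ((Over.map g).map h))
    (restrictions_restrict g a) (restrictions_map _)
    (fun h => restrictions_map a ((Over.map g).map h)) (restrictions_app p _)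
    (fun f => restrictions_app p a ((Over.map g).obj f))
  rw [← restrictions_restrict g]
  exact congrArg restrictions (NatTrans.naturality_apply p g.op a)

end Lifts

/-! ### The universe of small families -/

section Universe

variable {C : Type (max v (w + 1))} [SmallCategory.{max v (w + 1)} C]

/-- The Hofmann–Streicher universe: `U(c)` is the set of presheaves of small sets on `C/c`. -/
def Univ (C : Type (max v (w + 1))) [SmallCategory.{max v (w + 1)} C] : Psh C where
  obj c := (Over c.unop)ᵒᵖ ⥤ Type w
  map g := ↾fun α => (Over.map g.unop).op ⋙ α
  map_id c := by
    refine ConcreteCategory.hom_ext _ _ fun α => ?_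
    change (Over.map (𝟙 c.unop)).op ⋙ α = α
    rw [Over.mapId_eq]; rfl
  map_comp g g' := by
    refine ConcreteCategory.hom_ext _ _ fun α => ?_
    change (Over.map (g'.unop ≫ g.unop)).op ⋙ α = _
    rw [Over.mapComp_eq]; rfl

/-- The object `E` of pointed types: `E(c)` is the set of presheaves of pointed small sets on
`C/c`. -/
def Ptd (C : Type (max v (w + 1))) [SmallCategory.{max v (w + 1)} C] : Psh C where
  obj c := PointedPsh.{w, max v (w + 1)} (Over c.unop)
  map g := ↾fun β => β.precomp (Over.map g.unop)
  map_id c := ConcreteCategory.hom_ext _ _ fun β => β.precomp_congr (Over.mapId_eq c.unop)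
  map_comp g g' := ConcreteCategory.hom_ext _ _ fun β =>
    β.precomp_congr (Over.mapComp_eq g'.unop g.unop)

/-- The small map classifier `π : E ⟶ U`, forgetting the points. -/
def univProj (C : Type (max v (w + 1))) [SmallCategory.{max v (w + 1)} C] :
    Ptd.{w, v} C ⟶ Univ.{w, v} C where
  app _ := ↾fun β => β.psh
  naturality _ _ _ := rfl

/-- The comprehension `X.α` of a family `α : X ⟶ U`. -/
def compr {X : Psh C} (α : X ⟶ Univ.{w, v} C) : Psh C :=
  pullback α (univProj.{w, v} C)

/-- The display map `X.α ⟶ X` of a family `α : X ⟶ U`. -/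
def disp {X : Psh C} (α : X ⟶ Univ.{w, v} C) : compr α ⟶ X :=
  pullback.fst _ _

/-- The characteristic map `X ⟶ U` of a small map `p : A ⟶ X`: it sends `x ∈ X(c)` to the
presheaf `(f : d ⟶ c) ↦ {a ∈ A(d) | p(a) = x.f}` on `C/c`. -/
def charMap {A X : Psh C} (p : A ⟶ X) (hp : IsSmallMap.{w} p) : X ⟶ Univ.{w, v} C where
  app _ := ↾fun x => liftsPsh p hp (restrictions x) (restrictions_map x)
  naturality _ _ g :=
    ConcreteCategory.hom_ext _ _ fun x => liftsPsh_restrict p hp g.unop x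

/-- The canonical map `A ⟶ E` over the characteristic map of `p : A ⟶ X`: it sends `a ∈ A(c)` to
the presheaf of lifts of the restrictions of `p(a)`, pointed by the restrictions of `a`. -/
def charLift {A X : Psh C} (p : A ⟶ X) (hp : IsSmallMap.{w} p) : A ⟶ Ptd.{w, v} C where
  app c := ↾fun a => liftsPtd p hp (restrictions (p.app c a)) (restrictions_map _)
    (restrictions a) (restrictions_map a) (restrictions_app p a)
  naturality _ _ g :=
    ConcreteCategory.hom_ext _ _ fun a => liftsPtd_restrict p hp g.unop a

/-! ### The universal fibration -/

variable {W : MorphismProperty (Psh C)} (I : Interval W) {R : Psh C ⥤ Psh C}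
  (adj : ihom I.obj ⊣ R)

/-- The base `Fib = Fib*(id_U) = Σ α : U, Fib*(α)` of the universal fibration. -/
def Fib : Psh C := fibStarObj I adj (disp (𝟙 (Univ.{w, v} C)))

/-- The projection `Fib ⟶ U`. -/
def fibToUniv : Fib.{w, v} I adj ⟶ Univ.{w, v} C :=
  fibStarProj I adj (disp (𝟙 (Univ.{w, v} C)))

/-- The total space of the universal fibration, the pullback of `π : E ⟶ U` along `Fib ⟶ U`. -/
def FibPtd : Psh C := pullback (fibToUniv.{w, v} I adj) (univProj.{w, v} C)

/-- The universal fibration. -/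
def univFib : FibPtd.{w, v} I adj ⟶ Fib.{w, v} I adj := pullback.fst _ _

/-- The projection from the total space of the universal fibration to `E`. -/
def fibPtdToPtd : FibPtd.{w, v} I adj ⟶ Ptd.{w, v} C := pullback.snd _ _

end Universe

end PshFib

end

open PshFib

/-!
# The universal uniform fibration

A uniform fibration structure on `p : A ⟶ X` is the same thing as a section of the projection
`Fill(p) ⟶ X^I`. In one direction a structure is restricted to the inclusions of cofibrant sieves
into representables, whose open boxes are exactly the filling problems that occur in `Fill(p)`. In
the other direction the fillers against an arbitrary cofibration `m : S ⟶ T` are glued from the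
fillers over the elements `yc ⟶ T`, along which `m` pulls back to a cofibrant sieve; uniformity of
the local fillers is what makes them compatible (`LocalFilling.uniformFibration`,
`exists_uniformFibration_toSection_eq`). Under this correspondence the structure pulled back along a
cartesian square is given by the matching section (`preserved_iff_toSection`).

The object `Fill(p)` is stable under pullback: fillers for a pullback of `p` over a path are the
same as fillers for `p` over the image of the path (`isPullback_fillMap`). The root functor is a
right adjoint, so this gives the stability of `Fib*` (`isPullback_fibStarMap`).

A map `Y ⟶ Fib*(p)` over `t : Y ⟶ X` is by adjunction a map `Y^I ⟶ Fill(p)` over `t^I`, hence by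
stability a section of the filling structures of the pullback of `p` along `t`, hence a uniform
fibration structure on that pullback. The structure corresponding to the identity of `Fib*(p)` is
therefore generic (`exists_generic_uniformFibration`). For `p = π` this is the universal fibration,
because every small map is a pullback of `π` along its characteristic map (`isPullback_charLift`).
-/

namespace PshFib

/-! ### Presheaves, cylinders and sieves -/

section Presheaf

variable {C : Type u} [SmallCategory.{u} C]

theorem isPullback_of_existsUnique {P X Y Z : Psh C} {f : P ⟶ X} {g : P ⟶ Y} {h : X ⟶ Z}
    {k : Y ⟶ Z} (w : f ≫ h = g ≫ k)
    (H : ∀ (c : Cᵒᵖ) (x : X.obj c) (y : Y.obj c), h.app c x = k.app c y →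
      ∃! z, f.app c z = x ∧ g.app c z = y) : IsPullback f g h k := by
  refine IsPullback.of_forall_isPullback_app fun c => (Types.isPullback_iff _ _ _ _).2
    ⟨by rw [← NatTrans.comp_app, w, NatTrans.comp_app], ?_, fun x y e => (H c x y e).exists⟩
  rintro z z' ⟨e₁, e₂⟩
  have e := ConcreteCategory.congr_hom (NatTrans.congr_app w c) z'
  exact (H c (f.app c z') (g.app c z') e).unique ⟨e₁, e₂⟩ ⟨rfl, rfl⟩

theorem app_injective {S T : Psh C} (m : S ⟶ T) [Mono m] (c : Cᵒᵖ) :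
    Function.Injective (m.app c) :=
  (mono_iff_injective _).1 inferInstance

theorem psh_hom_ext {T A : Psh C} {f g : T ⟶ A}
    (H : ∀ (c : C) (τ : yoneda.obj c ⟶ T), τ ≫ f = τ ≫ g) : f = g := by
  ext c t
  have h := congrArg yonedaEquiv (H c.unop (yonedaEquiv.symm t))
  rwa [yonedaEquiv_comp, yonedaEquiv_comp, Equiv.apply_symm_apply] at h

/-- Maps out of a cylinder `J × T` are determined by their restrictions to the cylinders over the
elements of `T`. -/
theorem cylinder_hom_ext {J T A : Psh C} {f g : J ⊗ T ⟶ A}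
    (H : ∀ (c : C) (τ : yoneda.obj c ⟶ T), J ◁ τ ≫ f = J ◁ τ ≫ g) : f = g := by
  apply MonoidalClosed.curry_injective
  refine psh_hom_ext fun c τ => ?_
  rw [← MonoidalClosed.curry_natural_left, H, MonoidalClosed.curry_natural_left]

/-- The map out of the cylinder `J × T` glued from a compatible family of maps on the cylinders over
the elements of `T`. -/
noncomputable def cylinderGlue {J T A : Psh C}
    (F : ∀ {c : C}, (yoneda.obj c ⟶ T) → (J ⊗ yoneda.obj c ⟶ A))
    (hF : ∀ {c d : C} (g : d ⟶ c) (τ : yoneda.obj c ⟶ T),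
      F (yoneda.map g ≫ τ) = J ◁ yoneda.map g ≫ F τ) : J ⊗ T ⟶ A :=
  MonoidalClosed.uncurry
    { app c := ↾fun t => yonedaEquiv (MonoidalClosed.curry (F (yonedaEquiv.symm t)))
      naturality c d g := by
        ext t
        change yonedaEquiv (MonoidalClosed.curry (F (yonedaEquiv.symm (T.map g t)))) =
          ((ihom J).obj A).map g (yonedaEquiv (MonoidalClosed.curry (F (yonedaEquiv.symm t))))
        rw [yonedaEquiv_naturality', ← MonoidalClosed.curry_natural_left, ← hF,
          yonedaEquiv_symm_map] }

theorem whiskerLeft_cylinderGlue {J T A : Psh C}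
    (F : ∀ {c : C}, (yoneda.obj c ⟶ T) → (J ⊗ yoneda.obj c ⟶ A))
    (hF : ∀ {c d : C} (g : d ⟶ c) (τ : yoneda.obj c ⟶ T),
      F (yoneda.map g ≫ τ) = J ◁ yoneda.map g ≫ F τ) {c : C} (τ : yoneda.obj c ⟶ T) :
    J ◁ τ ≫ cylinderGlue F hF = F τ := by
  apply MonoidalClosed.curry_injective
  rw [MonoidalClosed.curry_natural_left, cylinderGlue, MonoidalClosed.curry_uncurry]
  apply yonedaEquiv.injective
  rw [yonedaEquiv_comp]
  change yonedaEquiv (MonoidalClosed.curry (F (yonedaEquiv.symm (yonedaEquiv τ)))) = _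
  rw [Equiv.symm_apply_apply]

/-- The pullback of a map `m : S ⟶ T` along an element `τ` of `T`, as a sieve. -/
def pullbackSieve {S T : Psh C} (m : S ⟶ T) {c : C} (τ : yoneda.obj c ⟶ T) : Sieve c where
  arrows d f := ∃ s : S.obj (op d), m.app (op d) s = τ.app (op d) f
  downward_closed := by
    rintro d e f ⟨s, hs⟩ g
    refine ⟨S.map g.op s, ?_⟩
    rw [NatTrans.naturality_apply, hs, ← NatTrans.naturality_apply]
    rfl

/-- The map from the sieve `pullbackSieve m τ` to `S`, where `m : S ⟶ T` is a monomorphism. -/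
noncomputable def pullbackSieveMap {S T : Psh C} (m : S ⟶ T) [Mono m] {c : C}
    (τ : yoneda.obj c ⟶ T) : (pullbackSieve m τ).functor ⟶ S where
  app d := ↾fun f => f.2.choose
  naturality d e g := by
    ext f
    apply app_injective m
    change m.app e (Exists.choose _) = m.app e (S.map g (Exists.choose _))
    have h := f.2.choose_spec
    rw [NatTrans.naturality_apply]
    refine Eq.trans (Exists.choose_spec (p := fun s => m.app e s = _) _) ?_
    erw [h]
    rw [← NatTrans.naturality_apply]
    rfl

theorem isPullback_pullbackSieveMap {S T : Psh C} (m : S ⟶ T) [Mono m] {c : C}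
    (τ : yoneda.obj c ⟶ T) :
    IsPullback (pullbackSieveMap m τ) (pullbackSieve m τ).functorInclusion m τ := by
  have key (d : Cᵒᵖ) (f : (pullbackSieve m τ).functor.obj d) :
      m.app d ((pullbackSieveMap m τ).app d f) = τ.app d f.1 :=
    f.2.choose_spec
  refine isPullback_of_existsUnique (by ext d f; exact key d f) fun d s f e => ?_
  refine ⟨⟨f, s, e⟩, ⟨app_injective m d ((key d _).trans e.symm), rfl⟩, ?_⟩
  rintro z ⟨-, hz⟩
  exact Subtype.ext hz

/-- A sieve on `e` that fits into a cartesian square over `g : e ⟶ d` is the pullback sieve. -/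
theorem sieve_eq_pullback {d e : C} {g : e ⟶ d} {φ : Sieve d} {φ' : Sieve e}
    {s : φ'.functor ⟶ φ.functor}
    (sq : IsPullback s φ'.functorInclusion φ.functorInclusion (yoneda.map g)) :
    φ' = φ.pullback g := by
  ext c f
  refine ⟨fun hf => ?_, fun hf => ?_⟩
  · have h := ConcreteCategory.congr_hom (NatTrans.congr_app sq.w (op c)) ⟨f, hf⟩
    have h' : (s.app (op c) ⟨f, hf⟩).1 = f ≫ g := h
    change φ (f ≫ g)
    exact h' ▸ (s.app (op c) ⟨f, hf⟩).2
  · obtain ⟨z, -, hz⟩ := Types.exists_of_isPullback (sq.app (op c)) ⟨f ≫ g, hf⟩ f rfl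
    exact (show z.1 = f from hz) ▸ z.2

theorem isPullback_sieveMap {d e : C} (g : e ⟶ d) (φ : Sieve d) :
    IsPullback (sieveMap g φ) (φ.pullback g).functorInclusion φ.functorInclusion
      (yoneda.map g) := by
  refine isPullback_of_existsUnique (sieveMap_incl g φ) fun c x f e => ?_
  have e' : x.1 = f ≫ g := e
  refine ⟨⟨f, show φ (f ≫ g) from e' ▸ x.2⟩, ⟨Subtype.ext e'.symm, rfl⟩, ?_⟩
  rintro z ⟨-, hz⟩
  exact Subtype.ext hz

end Presheaf

/-! ### Uniform fibrations and local fillers -/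

section Filling

variable {C : Type u} [SmallCategory.{u} C] {W : MorphismProperty (Psh C)} (I : Interval W)

/-- A choice of fillers for the open boxes `[φ] × I ∪ yd × {k}` with `φ` a cofibrant sieve on a
representable `yd`, stable under restriction along maps of representables. -/
structure LocalFilling {A X : Psh C} (p : A ⟶ X) where
  fill : ∀ {d : C} (k : Fin 2) (y : I.obj ⊗ yoneda.obj d ⟶ X) (φ : Sieve d)
    (v : I.obj ⊗ φ.functor ⟶ A) (a : yoneda.obj d ⟶ A), IsFillProblem I p k y φ v a →
    (I.obj ⊗ yoneda.obj d ⟶ A)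
  fill_over : ∀ {d : C} (k : Fin 2) (y : I.obj ⊗ yoneda.obj d ⟶ X) (φ : Sieve d)
    (v : I.obj ⊗ φ.functor ⟶ A) (a : yoneda.obj d ⟶ A) (h : IsFillProblem I p k y φ v a),
    fill k y φ v a h ≫ p = y
  endpoint : ∀ {d : C} (k : Fin 2) (y : I.obj ⊗ yoneda.obj d ⟶ X) (φ : Sieve d)
    (v : I.obj ⊗ φ.functor ⟶ A) (a : yoneda.obj d ⟶ A) (h : IsFillProblem I p k y φ v a),
    I.atEnd k (yoneda.obj d) ≫ fill k y φ v a h = a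
  extends_partial : ∀ {d : C} (k : Fin 2) (y : I.obj ⊗ yoneda.obj d ⟶ X) (φ : Sieve d)
    (v : I.obj ⊗ φ.functor ⟶ A) (a : yoneda.obj d ⟶ A) (h : IsFillProblem I p k y φ v a),
    I.obj ◁ φ.functorInclusion ≫ fill k y φ v a h = v
  natural : ∀ {d e : C} (g : e ⟶ d) (k : Fin 2) (y : I.obj ⊗ yoneda.obj d ⟶ X) (φ : Sieve d)
    (v : I.obj ⊗ φ.functor ⟶ A) (a : yoneda.obj d ⟶ A) (h : IsFillProblem I p k y φ v a)
    (h' : IsFillProblem I p k (I.obj ◁ yoneda.map g ≫ y) (φ.pullback g)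
      (I.obj ◁ sieveMap g φ ≫ v) (yoneda.map g ≫ a)),
    fill k (I.obj ◁ yoneda.map g ≫ y) (φ.pullback g) (I.obj ◁ sieveMap g φ ≫ v)
      (yoneda.map g ≫ a) h' = I.obj ◁ yoneda.map g ≫ fill k y φ v a h

variable {I}

theorem LocalFilling.fill_congr {A X : Psh C} {p : A ⟶ X} (L : LocalFilling I p) {d : C}
    {k : Fin 2} {y y' : I.obj ⊗ yoneda.obj d ⟶ X} (ey : y = y') {φ : Sieve d}
    {v v' : I.obj ⊗ φ.functor ⟶ A} (ev : v = v') {a a' : yoneda.obj d ⟶ A} (ea : a = a') (h h') :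
    L.fill k y φ v a h = L.fill k y' φ v' a' h' := by
  subst ey ev ea; rfl

theorem UniformFibration.fill_congr {A X : Psh C} {p : A ⟶ X} (j : UniformFibration I p)
    {S T : Psh C} {m : S ⟶ T} (hm : W m) {k : Fin 2} {a a' : I.ppObj m k ⟶ A} (ea : a = a')
    {x x' : I.obj ⊗ T ⟶ X} (ex : x = x') (h h') :
    j.fill m hm k a x h = j.fill m hm k a' x' h' := by
  subst ea ex; rfl

namespace Interval

variable (I)

/-- The inclusion of the end `T` into the domain of the pushout-product. -/
noncomputable def ppInl {S T : Psh C} (m : S ⟶ T) (k : Fin 2) : T ⟶ I.ppObj m k :=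
  pushout.inl _ _

/-- The inclusion of the cylinder `I × S` into the domain of the pushout-product. -/
noncomputable def ppInr {S T : Psh C} (m : S ⟶ T) (k : Fin 2) : I.obj ⊗ S ⟶ I.ppObj m k :=
  pushout.inr _ _

variable {I} {S T A : Psh C} {m : S ⟶ T} {k : Fin 2}

theorem pp_hom_ext {f g : I.ppObj m k ⟶ A} (h : I.ppInl m k ≫ f = I.ppInl m k ≫ g)
    (h' : I.ppInr m k ≫ f = I.ppInr m k ≫ g) : f = g :=
  pushout.hom_ext h h'

theorem comp_ppInl : m ≫ I.ppInl m k = I.atEnd k S ≫ I.ppInr m k :=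
  pushout.condition

theorem ppInl_pp : I.ppInl m k ≫ I.pp m k = I.atEnd k T :=
  pushout.inl_desc _ _ _

theorem ppInr_pp : I.ppInr m k ≫ I.pp m k = I.obj ◁ m :=
  pushout.inr_desc _ _ _

theorem ppInl_ppMap {S' T' : Psh C} {s : S' ⟶ S} {m' : S' ⟶ T'} {t : T' ⟶ T}
    (sq : CommSq s m' m t) : I.ppInl m' k ≫ I.ppMap sq k = t ≫ I.ppInl m k :=
  pushout.inl_desc _ _ _

theorem ppInr_ppMap {S' T' : Psh C} {s : S' ⟶ S} {m' : S' ⟶ T'} {t : T' ⟶ T}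
    (sq : CommSq s m' m t) : I.ppInr m' k ≫ I.ppMap sq k = I.obj ◁ s ≫ I.ppInr m k :=
  pushout.inr_desc _ _ _

end Interval

namespace IsFillProblem

variable {A X : Psh C} {p : A ⟶ X} {k : Fin 2} {d : C} {y : I.obj ⊗ yoneda.obj d ⟶ X}
  {φ : Sieve d} {v : I.obj ⊗ φ.functor ⟶ A} {a : yoneda.obj d ⟶ A}

/-- The map out of the pushout-product corner given by the two halves of a filling problem. -/
noncomputable def corner (h : IsFillProblem I p k y φ v a) :
    I.ppObj φ.functorInclusion k ⟶ A :=
  pushout.desc a v h.compat.symm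

theorem ppInl_corner (h : IsFillProblem I p k y φ v a) : I.ppInl _ k ≫ h.corner = a :=
  pushout.inl_desc _ _ _

theorem ppInr_corner (h : IsFillProblem I p k y φ v a) : I.ppInr _ k ≫ h.corner = v :=
  pushout.inr_desc _ _ _

theorem corner_comp (h : IsFillProblem I p k y φ v a) :
    h.corner ≫ p = I.pp φ.functorInclusion k ≫ y := by
  apply Interval.pp_hom_ext
  · rw [reassoc_of% h.ppInl_corner, reassoc_of% (Interval.ppInl_pp (I := I)), h.a_over]
  · rw [reassoc_of% h.ppInr_corner, reassoc_of% (Interval.ppInr_pp (I := I)), h.v_over]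

theorem ppMap_corner {e : C} {g : e ⟶ d} (h : IsFillProblem I p k y φ v a)
    (h' : IsFillProblem I p k (I.obj ◁ yoneda.map g ≫ y) (φ.pullback g)
      (I.obj ◁ sieveMap g φ ≫ v) (yoneda.map g ≫ a)) :
    I.ppMap (isPullback_sieveMap g φ).toCommSq k ≫ h.corner = h'.corner := by
  apply Interval.pp_hom_ext
  · rw [h'.ppInl_corner, reassoc_of% (Interval.ppInl_ppMap (I := I)), h.ppInl_corner]
  · rw [h'.ppInr_corner, reassoc_of% (Interval.ppInr_ppMap (I := I)), h.ppInr_corner]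

end IsFillProblem

/-- The restriction of a uniform fibration structure to the inclusions of cofibrant sieves. -/
noncomputable def UniformFibration.localFilling {A X : Psh C} {p : A ⟶ X}
    (j : UniformFibration I p) : LocalFilling I p where
  fill k y φ v a h := j.fill φ.functorInclusion h.cof k h.corner y h.corner_comp
  fill_over k y φ v a h := j.fill_proj _ _ _ _ _ _
  endpoint k y φ v a h := by
    have e := j.pp_fill φ.functorInclusion h.cof k h.corner y h.corner_comp
    rw [← reassoc_of% (Interval.ppInl_pp (I := I) (m := φ.functorInclusion) (k := k)), e,
      h.ppInl_corner]
  extends_partial k y φ v a h := by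
    have e := j.pp_fill φ.functorInclusion h.cof k h.corner y h.corner_comp
    rw [← reassoc_of% (Interval.ppInr_pp (I := I) (m := φ.functorInclusion) (k := k)), e,
      h.ppInr_corner]
  natural g k y φ v a h h' := by
    rw [← j.uniform (isPullback_sieveMap g φ) h'.cof h.cof k h.corner y h.corner_comp
      (by rw [h.ppMap_corner h']; exact h'.corner_comp)]
    exact j.fill_congr _ (h.ppMap_corner h').symm rfl _ _

/-- The restriction of a lifting problem against `m ⊗ δᵏ` to an element `τ` of the codomain of `m`
is a filling problem on the sieve obtained by pulling `m` back along `τ`. -/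
theorem isFillProblem_of_isPullback (hW : IsCofibrationClass W) {A X : Psh C} {p : A ⟶ X}
    {S T : Psh C} {m : S ⟶ T} (hm : W m) {k : Fin 2} {a : I.ppObj m k ⟶ A} {x : I.obj ⊗ T ⟶ X}
    (h : a ≫ p = I.pp m k ≫ x) {c : C} {φ : Sieve c} {s : φ.functor ⟶ S} {τ : yoneda.obj c ⟶ T}
    (sq : IsPullback s φ.functorInclusion m τ) :
    IsFillProblem I p k (I.obj ◁ τ ≫ x) φ (I.obj ◁ s ≫ I.ppInr m k ≫ a)
      (τ ≫ I.ppInl m k ≫ a) where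
  cof := hW.pullback sq hm
  v_over := by
    rw [Category.assoc, Category.assoc, h, reassoc_of% (Interval.ppInr_pp (I := I)),
      ← whiskerLeft_comp_assoc, sq.w,
      whiskerLeft_comp_assoc]
  a_over := by
    rw [Category.assoc, Category.assoc, h, reassoc_of% (Interval.ppInl_pp (I := I)),
      reassoc_of% (I.atEnd_naturality k τ)]
  compat := by
    rw [← reassoc_of% (I.atEnd_naturality k s), ← reassoc_of% sq.w]
    rw [reassoc_of% (Interval.comp_ppInl (I := I) (m := m) (k := k))]

namespace LocalFilling

variable {A X : Psh C} {p : A ⟶ X} (L : LocalFilling I p)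

/-- Naturality of local fillers for any presentation of the pulled back sieve. -/
theorem natural_of_isPullback {d e : C} (g : e ⟶ d) {k : Fin 2} {y : I.obj ⊗ yoneda.obj d ⟶ X}
    {φ : Sieve d} {v : I.obj ⊗ φ.functor ⟶ A} {a : yoneda.obj d ⟶ A}
    {y' : I.obj ⊗ yoneda.obj e ⟶ X}
    {φ' : Sieve e} {v' : I.obj ⊗ φ'.functor ⟶ A} {a' : yoneda.obj e ⟶ A}
    {s : φ'.functor ⟶ φ.functor}
    (sq : IsPullback s φ'.functorInclusion φ.functorInclusion (yoneda.map g))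
    (hy : y' = I.obj ◁ yoneda.map g ≫ y) (hv : v' = I.obj ◁ s ≫ v) (ha : a' = yoneda.map g ≫ a)
    (h : IsFillProblem I p k y φ v a) (h' : IsFillProblem I p k y' φ' v' a') :
    L.fill k y' φ' v' a' h' = I.obj ◁ yoneda.map g ≫ L.fill k y φ v a h := by
  obtain rfl := sieve_eq_pullback sq
  obtain rfl : s = sieveMap g φ := by
    rw [← cancel_mono φ.functorInclusion, sq.w, sieveMap_incl]
  subst hy hv ha
  exact L.natural g k y φ v a h h'

/-- The fillers of the restrictions of a lifting problem to the elements of `T` are compatible. -/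
theorem fill_natural (hW : IsCofibrationClass W) {S T : Psh C} {m : S ⟶ T} (hm : W m) {k : Fin 2}
    {a : I.ppObj m k ⟶ A} {x : I.obj ⊗ T ⟶ X} (h : a ≫ p = I.pp m k ≫ x) {c d : C} (g : d ⟶ c)
    {τ : yoneda.obj c ⟶ T} {τ' : yoneda.obj d ⟶ T} (hτ : τ' = yoneda.map g ≫ τ)
    {φ : Sieve c} {s : φ.functor ⟶ S} (sq : IsPullback s φ.functorInclusion m τ)
    {φ' : Sieve d} {s' : φ'.functor ⟶ S} (sq' : IsPullback s' φ'.functorInclusion m τ') :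
    L.fill k _ φ' _ _ (isFillProblem_of_isPullback hW hm h sq') =
      I.obj ◁ yoneda.map g ≫ L.fill k _ φ _ _ (isFillProblem_of_isPullback hW hm h sq) := by
  subst hτ
  have e : s' ≫ m = (φ'.functorInclusion ≫ yoneda.map g) ≫ τ := by rw [sq'.w, Category.assoc]
  have hs : IsPullback (sq.lift s' _ e) φ'.functorInclusion φ.functorInclusion (yoneda.map g) :=
    IsPullback.of_right (by simpa using sq') (sq.lift_snd _ _ _) sq
  refine L.natural_of_isPullback g hs ?_ ?_ ?_ _ _
  · rw [whiskerLeft_comp_assoc]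
  · rw [← whiskerLeft_comp_assoc, sq.lift_fst]
  · rw [Category.assoc]

theorem fill_natural_id (hW : IsCofibrationClass W) {S T : Psh C} {m : S ⟶ T} (hm : W m)
    {k : Fin 2} {a : I.ppObj m k ⟶ A} {x : I.obj ⊗ T ⟶ X} (h : a ≫ p = I.pp m k ≫ x) {c : C}
    {τ : yoneda.obj c ⟶ T}
    {φ : Sieve c} {s : φ.functor ⟶ S} (sq : IsPullback s φ.functorInclusion m τ)
    {φ' : Sieve c} {s' : φ'.functor ⟶ S} (sq' : IsPullback s' φ'.functorInclusion m τ) :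
    L.fill k _ φ' _ _ (isFillProblem_of_isPullback hW hm h sq') =
      L.fill k _ φ _ _ (isFillProblem_of_isPullback hW hm h sq) := by
  rw [L.fill_natural hW hm h (𝟙 c) (by simp) sq sq']
  simp

/-- The filler against an arbitrary cofibration, glued from the local fillers over the elements of
its codomain. -/
noncomputable def glue (hW : IsCofibrationClass W) {S T : Psh C} {m : S ⟶ T} (hm : W m) {k : Fin 2}
    {a : I.ppObj m k ⟶ A} {x : I.obj ⊗ T ⟶ X} (h : a ≫ p = I.pp m k ≫ x) : I.obj ⊗ T ⟶ A :=
  haveI := hW.mono m hm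
  cylinderGlue
    (fun τ => L.fill k _ _ _ _
      (isFillProblem_of_isPullback hW hm h (isPullback_pullbackSieveMap m τ)))
    (fun g τ => L.fill_natural hW hm h g rfl (isPullback_pullbackSieveMap m τ)
      (isPullback_pullbackSieveMap m _))

/-- Over an element of `T`, the glued filler is the local filler, for any presentation of the
pullback of `m` along the element as a sieve. -/
theorem whiskerLeft_glue (hW : IsCofibrationClass W) {S T : Psh C} {m : S ⟶ T} (hm : W m)
    {k : Fin 2} {a : I.ppObj m k ⟶ A} {x : I.obj ⊗ T ⟶ X} (h : a ≫ p = I.pp m k ≫ x) {c : C}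
    {τ : yoneda.obj c ⟶ T} {φ : Sieve c} {s : φ.functor ⟶ S}
    (sq : IsPullback s φ.functorInclusion m τ) :
    I.obj ◁ τ ≫ L.glue hW hm h = L.fill k _ φ _ _ (isFillProblem_of_isPullback hW hm h sq) := by
  have := hW.mono m hm
  exact (whiskerLeft_cylinderGlue _ (fun g τ => L.fill_natural hW hm h g rfl
    (isPullback_pullbackSieveMap m τ) (isPullback_pullbackSieveMap m _)) τ).trans
    (L.fill_natural_id hW hm h sq (isPullback_pullbackSieveMap m τ))

/-- A local choice of fillers extends to a uniform fibration structure. -/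
noncomputable def uniformFibration (hW : IsCofibrationClass W) : UniformFibration I p where
  fill m hm k a x h := L.glue hW hm h
  pp_fill {S T} m hm k a x h := by
    have := hW.mono m hm
    apply Interval.pp_hom_ext
    · rw [reassoc_of% (Interval.ppInl_pp (I := I))]
      refine psh_hom_ext fun c τ => ?_
      rw [reassoc_of% (I.atEnd_naturality k τ),
        L.whiskerLeft_glue hW hm h (isPullback_pullbackSieveMap m τ), L.endpoint]
    · rw [reassoc_of% (Interval.ppInr_pp (I := I))]
      refine cylinder_hom_ext fun c σ => ?_
      -- Over an element `σ` of `S` the sieve is maximal, so the partial section is total.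
      have sq : IsPullback ((⊤ : Sieve c).functorInclusion ≫ σ) (⊤ : Sieve c).functorInclusion
          m (σ ≫ m) :=
        isPullback_of_existsUnique (Category.assoc _ _ _) fun d s f e =>
          ⟨⟨f, trivial⟩, ⟨app_injective m d e.symm, rfl⟩, fun z hz => Subtype.ext hz.2⟩
      rw [← whiskerLeft_comp_assoc, L.whiskerLeft_glue hW hm h sq,
        ← cancel_epi (I.obj ◁ (⊤ : Sieve c).functorInclusion), L.extends_partial,
        whiskerLeft_comp_assoc]
  fill_proj m hm k a x h := by
    have := hW.mono m hm
    refine cylinder_hom_ext fun c τ => ?_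
    rw [reassoc_of% (L.whiskerLeft_glue hW hm h (isPullback_pullbackSieveMap m τ)), L.fill_over]
  uniform {S' S T' T s m' m t} sq hm' hm k a x h h' := by
    have := hW.mono m' hm'
    refine cylinder_hom_ext fun c τ => ?_
    have sq' := (isPullback_pullbackSieveMap m' τ).paste_horiz sq
    refine (L.whiskerLeft_glue hW hm' h' (isPullback_pullbackSieveMap m' τ)).trans
      (Eq.trans ?_ ((L.whiskerLeft_glue hW hm h sq').symm.trans
        (whiskerLeft_comp_assoc _ _ _ _)))
    refine L.fill_congr ?_ ?_ ?_ _ _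
    · rw [whiskerLeft_comp_assoc]
    · rw [reassoc_of% (Interval.ppInr_ppMap (I := I)), whiskerLeft_comp_assoc]
    · rw [reassoc_of% (Interval.ppInl_ppMap (I := I)), Category.assoc]

/-- A sieve is the pullback of its own inclusion along the identity, so gluing changes no filler
against a cofibrant sieve. -/
theorem localFilling_uniformFibration_fill (hW : IsCofibrationClass W) {d : C} {k : Fin 2}
    {y : I.obj ⊗ yoneda.obj d ⟶ X} {φ : Sieve d} {v : I.obj ⊗ φ.functor ⟶ A}
    {a : yoneda.obj d ⟶ A} (h : IsFillProblem I p k y φ v a) :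
    (L.uniformFibration hW).localFilling.fill k y φ v a h = L.fill k y φ v a h := by
  have sq : IsPullback (𝟙 φ.functor) φ.functorInclusion φ.functorInclusion (𝟙 _) :=
    IsPullback.of_horiz_isIso ⟨by simp⟩
  refine Eq.trans (by simp; rfl) ((L.whiskerLeft_glue hW h.cof h.corner_comp sq).trans
    (L.fill_congr ?_ ?_ ?_ _ _))
  · simp
  · rw [h.ppInr_corner, MonoidalCategory.whiskerLeft_id, Category.id_comp]
  · rw [h.ppInl_corner, Category.id_comp]

end LocalFilling

end Filling

/-! ### Sections of the object of filling structures -/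

section Sections

variable {C : Type u} [SmallCategory.{u} C] {W : MorphismProperty (Psh C)} (I : Interval W)

/-- The element of the path object corresponding to a map `I × yc ⟶ X`. -/
noncomputable def pathElt {X : Psh C} {c : C} (y : I.obj ⊗ yoneda.obj c ⟶ X) :
    (pathObj I X).obj (op c) :=
  yonedaEquiv (MonoidalClosed.curry y)

theorem pathMap_pathElt {X : Psh C} {c : C} (y : I.obj ⊗ yoneda.obj c ⟶ X) :
    pathMap I (pathElt I y) = y := by
  rw [pathMap, pathElt, Equiv.symm_apply_apply, MonoidalClosed.uncurry_curry]

theorem pathElt_pathMap {X : Psh C} {c : C} (x : (pathObj I X).obj (op c)) :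
    pathElt I (pathMap I x) = x := by
  rw [pathMap, pathElt, MonoidalClosed.curry_uncurry, Equiv.apply_symm_apply]

theorem pathElt_whiskerLeft {X : Psh C} {c d : C} (g : d ⟶ c)
    (y : I.obj ⊗ yoneda.obj c ⟶ X) :
    pathElt I (I.obj ◁ yoneda.map g ≫ y) = (pathObj I X).map g.op (pathElt I y) := by
  rw [pathElt, pathElt, MonoidalClosed.curry_natural_left, yonedaEquiv_naturality]

variable {I}

theorem FillElt.fill_eq_of_eq {A X : Psh C} {p : A ⟶ X} {c : C} {x y : FillElt I p c} (e : x = y)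
    {d : C} (f : d ⟶ c) (k : Fin 2) (φ : Sieve d) (v : I.obj ⊗ φ.functor ⟶ A)
    (a : yoneda.obj d ⟶ A) (h h') : x.fill f k φ v a h = y.fill f k φ v a h' := by
  subst e; rfl

namespace LocalFilling

variable {A X : Psh C} {p : A ⟶ X} (L : LocalFilling I p)

/-- The filling structure over a path given by a local choice of fillers. -/
def fillElt {c : C} (x : (pathObj I X).obj (op c)) : FillElt I p c where
  path := x
  fill _ k φ v a h := L.fill k _ φ v a h
  fill_over _ k φ v a h := L.fill_over k _ φ v a h
  endpoint _ k φ v a h := L.endpoint k _ φ v a h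
  extends_partial _ k φ v a h := L.extends_partial k _ φ v a h
  natural f g k φ v a h h' := by
    have e : I.obj ◁ yoneda.map (g ≫ f) ≫ pathMap I x =
        I.obj ◁ yoneda.map g ≫ I.obj ◁ yoneda.map f ≫ pathMap I x := by simp
    rw [L.fill_congr e rfl rfl h' (h'.congr I e), L.natural g k _ φ v a h]

/-- The section of `Fill(α ∘ x) ⟶ X^I` given by a local choice of fillers. -/
def toSection : pathObj I X ⟶ fillObj I p where
  app c := ↾fun x => L.fillElt (c := c.unop) x
  naturality c c' g := by
    ext x
    exact FillElt.ext' I rfl fun f k φ v a h₁ h₂ =>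
      L.fill_congr (path_restrict I g.unop f x) rfl rfl _ _

theorem toSection_fillProj : L.toSection ≫ fillProj I p = 𝟙 (pathObj I X) := rfl

end LocalFilling

section OfSection

variable {A X : Psh C} {p : A ⟶ X} {σ : pathObj I X ⟶ fillObj I p}

/-- The value of a section of `Fill(α ∘ x)` at a path, as a filling structure. -/
def sectionElt (σ : pathObj I X ⟶ fillObj I p) {c : C} (x : (pathObj I X).obj (op c)) :
    FillElt I p c :=
  σ.app (op c) x

theorem sectionElt_path (hσ : σ ≫ fillProj I p = 𝟙 (pathObj I X)) {c : C}
    (x : (pathObj I X).obj (op c)) : (sectionElt σ x).path = x := by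
  have h := ConcreteCategory.congr_hom (NatTrans.congr_app hσ (op c)) x
  exact h

theorem sectionElt_map (σ : pathObj I X ⟶ fillObj I p) {c d : C} (g : d ⟶ c)
    (x : (pathObj I X).obj (op c)) :
    sectionElt σ ((pathObj I X).map g.op x) = (sectionElt σ x).restrict I g :=
  NatTrans.naturality_apply σ g.op x

theorem sectionElt_problem (hσ : σ ≫ fillProj I p = 𝟙 (pathObj I X)) {d : C}
    (y : I.obj ⊗ yoneda.obj d ⟶ X) :
    y = I.obj ◁ yoneda.map (𝟙 d) ≫ pathMap I (sectionElt σ (pathElt I y)).path := by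
  rw [sectionElt_path hσ, pathMap_pathElt]
  simp

/-- By naturality, the values of a section at restricted paths determine all its fillers. -/
theorem sectionElt_fill_map (σ : pathObj I X ⟶ fillObj I p) {c d : C}
    (x : (pathObj I X).obj (op c)) (f : d ⟶ c) {k : Fin 2} {φ : Sieve d}
    {v : I.obj ⊗ φ.functor ⟶ A} {a : yoneda.obj d ⟶ A} {x' : (pathObj I X).obj (op d)} (e : x' = (pathObj I X).map f.op x) (h) (h') :
    (sectionElt σ x').fill (𝟙 d) k φ v a h = (sectionElt σ x).fill f k φ v a h' := by
  subst e
  have e := sectionElt_map σ f x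
  rw [FillElt.fill_eq_of_eq e (𝟙 d) k φ v a h (e ▸ h)]
  exact (sectionElt σ x).fill_congr I (Category.id_comp f) rfl rfl _ _

/-- The local choice of fillers given by a section of `Fill(α ∘ x) ⟶ X^I`. -/
noncomputable def LocalFilling.ofSection (hσ : σ ≫ fillProj I p = 𝟙 (pathObj I X)) :
    LocalFilling I p where
  fill {d} k y φ v a h := (sectionElt σ (pathElt I y)).fill (𝟙 d) k φ v a
    (h.congr I (sectionElt_problem hσ y))
  fill_over k y φ v a h := (FillElt.fill_over _ _ _ _ _ _ _).trans (sectionElt_problem hσ y).symm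
  endpoint k y φ v a h := FillElt.endpoint _ _ _ _ _ _ _
  extends_partial k y φ v a h := FillElt.extends_partial _ _ _ _ _ _ _
  natural {d e} g k y φ v a h h' := by
    have hy : I.obj ◁ yoneda.map g ≫ y =
        I.obj ◁ yoneda.map (g ≫ 𝟙 d) ≫ pathMap I (sectionElt σ (pathElt I y)).path := by
      rw [sectionElt_path hσ, pathMap_pathElt, Category.comp_id]
    rw [← (sectionElt σ (pathElt I y)).natural (𝟙 d) g k φ v a
      (h.congr I (sectionElt_problem hσ y)) (h'.congr I hy)]
    exact sectionElt_fill_map σ (pathElt I y) (g ≫ 𝟙 d)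
      (by rw [Category.comp_id, pathElt_whiskerLeft]) _ _

/-- The fillers of a section at `f : d ⟶ c` over a path `x` are, by naturality, its fillers at the
identity over the restriction of `x`, which are those recorded by `LocalFilling.ofSection`. -/
theorem LocalFilling.toSection_ofSection (hσ : σ ≫ fillProj I p = 𝟙 (pathObj I X)) :
    (LocalFilling.ofSection hσ).toSection = σ := by
  ext c x
  refine FillElt.ext' I (sectionElt_path hσ x).symm fun {d} f k φ v a h₁ h₂ => ?_
  exact sectionElt_fill_map σ x f (by rw [pathElt_whiskerLeft, pathElt_pathMap]) _ h₂

end OfSection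

/-- Every section of `Fill(α ∘ x) ⟶ X^I` is induced by a uniform fibration structure. -/
theorem exists_uniformFibration_toSection_eq (hW : IsCofibrationClass W) {A X : Psh C} {p : A ⟶ X}
    {σ : pathObj I X ⟶ fillObj I p} (hσ : σ ≫ fillProj I p = 𝟙 (pathObj I X)) :
    ∃ j : UniformFibration I p, j.localFilling.toSection = σ := by
  refine ⟨(LocalFilling.ofSection hσ).uniformFibration hW,
    Eq.trans ?_ (LocalFilling.toSection_ofSection hσ)⟩
  ext c x
  exact FillElt.ext' I rfl fun f k φ v a h₁ h₂ =>
    (LocalFilling.ofSection hσ).localFilling_uniformFibration_fill hW h₁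

/-! ### Filling structures and pullback squares -/

section Pullback

variable {A X B Y : Psh C} {p : A ⟶ X} {p' : B ⟶ Y} {q : B ⟶ A} {t : Y ⟶ X}
  (sq : IsPullback q p' p t)

/-- The pullback of a filling structure along a cartesian square. -/
noncomputable def FillElt.pull {c : C} (z : FillElt I p c) (y : (pathObj I Y).obj (op c))
    (e : z.path = ((ihom I.obj).map t).app (op c) y) : FillElt I p' c where
  path := y
  fill f k φ v a h := sq.lift
    (z.fill f k φ (v ≫ q) (a ≫ q) ((h.comp I sq.w).congr I (by rw [e, path_push])))
    (I.obj ◁ yoneda.map f ≫ pathMap I y) (by rw [z.fill_over, e, path_push])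
  fill_over f k φ v a h := sq.lift_snd _ _ _
  endpoint f k φ v a h := by
    apply sq.hom_ext
    · rw [Category.assoc, sq.lift_fst, z.endpoint]
    · rw [Category.assoc, sq.lift_snd, h.a_over]
  extends_partial f k φ v a h := by
    apply sq.hom_ext
    · rw [Category.assoc, sq.lift_fst, z.extends_partial]
    · rw [Category.assoc, sq.lift_snd, h.v_over]
  natural f g k φ v a h h' := by
    have hz := (h.comp I sq.w).congr I (show _ = I.obj ◁ yoneda.map f ≫ pathMap I z.path by
      rw [e, path_push])
    have hz' := (h'.comp I sq.w).congr I
      (show _ = I.obj ◁ yoneda.map (g ≫ f) ≫ pathMap I z.path by rw [e, path_push])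
    have n := z.natural f g k φ (v ≫ q) (a ≫ q) hz (by simpa only [Category.assoc] using hz')
    apply sq.hom_ext
    · refine (sq.lift_fst _ _ _).trans (Eq.trans ?_
        ((congrArg (_ ≫ ·) (sq.lift_fst _ _ _)).symm.trans (Category.assoc _ _ _).symm))
      exact (z.fill_congr I rfl (Category.assoc _ _ _) (Category.assoc _ _ _) _ _).trans n
    · refine (sq.lift_snd _ _ _).trans (Eq.trans ?_
        ((congrArg (_ ≫ ·) (sq.lift_snd _ _ _)).symm.trans (Category.assoc _ _ _).symm))
      simp

/-- Filling structures are stable under pullback: the object of filling structures of a pullback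
is the pullback of the object of filling structures. -/
theorem isPullback_fillMap :
    IsPullback (fillMap I sq) (fillProj I p') (fillProj I p) ((ihom I.obj).map t) := by
  refine isPullback_of_existsUnique (fillMap_fillProj I sq) fun c z y e =>
    ⟨FillElt.pull sq z y e, ⟨?_, rfl⟩, ?_⟩
  · refine FillElt.ext' I (Eq.symm e) fun f k φ v a h₁ h₂ => ?_
    exact (sq.lift_fst _ _ _).trans
      (FillElt.fill_congr I z rfl (liftV_fst I sq _) (liftA_fst I sq _) _ _)
  · rintro x ⟨hx, hx'⟩
    change FillElt.push I sq x = z at hx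
    change x.path = y at hx'
    subst hx hx'
    refine FillElt.ext' I rfl fun f k φ v a h₁ h₂ => sq.hom_ext ?_ ?_
    · refine Eq.trans ?_ (sq.lift_fst _ _ _).symm
      refine congrArg (· ≫ q) (x.fill_congr I rfl (sq.hom_ext ?_ ?_) (sq.hom_ext ?_ ?_) _ _)
      · rw [liftV_fst]
      · rw [liftV_snd, h₁.v_over]
      · rw [liftA_fst]
      · rw [liftA_snd, h₁.a_over]
    · exact (x.fill_over _ _ _ _ _ _).trans (sq.lift_snd _ _ _).symm

theorem fillMap_comp {D Z : Psh C} {p'' : D ⟶ Z} {q' : D ⟶ B} {t' : Z ⟶ Y}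
    (sq' : IsPullback q' p'' p' t') :
    fillMap I sq' ≫ fillMap I sq = fillMap I (sq'.paste_horiz sq) := by
  ext c x
  refine FillElt.ext' I ?_ fun f k φ v a h₁ h₂ => ?_
  · change (ConcreteCategory.hom (((ihom I.obj).map t).app c))
      ((ConcreteCategory.hom (((ihom I.obj).map t').app c)) x.path) =
      (ConcreteCategory.hom (((ihom I.obj).map (t' ≫ t)).app c)) x.path
    rw [Functor.map_comp]
    rfl
  · refine Eq.trans (Category.assoc _ _ _)
      (congrArg (· ≫ q' ≫ q) (x.fill_congr I rfl ?_ ?_ _ _))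
    · apply sq'.hom_ext
      · apply sq.hom_ext
        · rw [liftV_fst, liftV_fst, Category.assoc]
          exact (liftV_fst I (sq'.paste_horiz sq) _).symm
        · rw [liftV_fst, liftV_snd, Category.assoc, sq'.w,
            reassoc_of% (liftV_snd I (sq'.paste_horiz sq))]
          exact congrArg (_ ≫ ·) (path_push I t' f _)
      · rw [liftV_snd]
        exact (liftV_snd I (sq'.paste_horiz sq) _).symm
    · apply sq'.hom_ext
      · apply sq.hom_ext
        · rw [liftA_fst, liftA_fst, Category.assoc]
          exact (liftA_fst I (sq'.paste_horiz sq) _).symm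
        · rw [liftA_fst, liftA_snd, Category.assoc, sq'.w,
            reassoc_of% (liftA_snd I (sq'.paste_horiz sq))]
          exact congrArg (_ ≫ ·) (path_push I t' f _)
      · rw [liftA_snd]
        exact (liftA_snd I (sq'.paste_horiz sq) _).symm

end Pullback

/-! ### Pulled back structures and sections -/

section Preserved

variable {A X B Y : Psh C} {p : A ⟶ X} {p' : B ⟶ Y} {r : A ⟶ B} {χ : X ⟶ Y}

/-- By uniformity, a filler against `m ⊗ δᵏ` is determined by the fillers against the sieves
obtained by pulling `m` back along the elements of its codomain. -/
theorem UniformFibration.whiskerLeft_fill (hW : IsCofibrationClass W) (j : UniformFibration I p)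
    {S T : Psh C} {m : S ⟶ T} (hm : W m) {k : Fin 2} {a : I.ppObj m k ⟶ A} {x : I.obj ⊗ T ⟶ X}
    (h : a ≫ p = I.pp m k ≫ x) {c : C} {τ : yoneda.obj c ⟶ T} {φ : Sieve c} {s : φ.functor ⟶ S}
    (sq : IsPullback s φ.functorInclusion m τ) :
    I.obj ◁ τ ≫ j.fill m hm k a x h =
      j.localFilling.fill k _ φ _ _ (isFillProblem_of_isPullback hW hm h sq) := by
  have hc : I.ppMap sq.toCommSq k ≫ a = (isFillProblem_of_isPullback hW hm h sq).corner := by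
    apply Interval.pp_hom_ext
    · rw [reassoc_of% (Interval.ppInl_ppMap (I := I)), IsFillProblem.ppInl_corner]
    · rw [reassoc_of% (Interval.ppInr_ppMap (I := I)), IsFillProblem.ppInr_corner]
  rw [← j.uniform sq (hW.pullback sq hm) hm k a x h
    (by rw [hc]; exact IsFillProblem.corner_comp _)]
  exact j.fill_congr _ hc rfl _ _

theorem IsFillProblem.corner_postcomp (w : r ≫ p' = p ≫ χ) {k : Fin 2} {d : C}
    {y : I.obj ⊗ yoneda.obj d ⟶ X} {φ : Sieve d} {v : I.obj ⊗ φ.functor ⟶ A}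
    {a : yoneda.obj d ⟶ A} (h : IsFillProblem I p k y φ v a) :
    h.corner ≫ r = (h.comp I w).corner := by
  apply Interval.pp_hom_ext
  · rw [reassoc_of% h.ppInl_corner, IsFillProblem.ppInl_corner]
  · rw [reassoc_of% h.ppInr_corner, IsFillProblem.ppInr_corner]

/-- Preservation of fillers only needs to be checked against cofibrant sieves. -/
theorem preserved_iff_local (hW : IsCofibrationClass W) (w : r ≫ p' = p ≫ χ)
    (j : UniformFibration I p) (j' : UniformFibration I p') :
    j.Preserved I j' r χ ↔ ∀ {d : C} (k : Fin 2) (y : I.obj ⊗ yoneda.obj d ⟶ X) (φ : Sieve d)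
      (v : I.obj ⊗ φ.functor ⟶ A) (a : yoneda.obj d ⟶ A) (h : IsFillProblem I p k y φ v a),
      j'.localFilling.fill k (y ≫ χ) φ (v ≫ r) (a ≫ r) (h.comp I w) =
        j.localFilling.fill k y φ v a h ≫ r := by
  constructor
  · intro H d k y φ v a h
    refine Eq.trans ?_ (H φ.functorInclusion h.cof k h.corner y h.corner_comp
      (by rw [Category.assoc, w, reassoc_of% h.corner_comp]))
    exact j'.fill_congr _ (h.corner_postcomp w).symm rfl _ _
  · intro H S T m hm k a x h h'
    have := hW.mono m hm
    refine cylinder_hom_ext fun c τ => ?_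
    have sq := isPullback_pullbackSieveMap m τ
    rw [j'.whiskerLeft_fill hW hm h' sq, reassoc_of% (j.whiskerLeft_fill hW hm h sq), ← H]
    exact j'.localFilling.fill_congr (by simp) (by simp) (by simp) _ _

/-- A uniform fibration structure is the one pulled back along a cartesian square exactly if the
corresponding sections of filling structures match. -/
theorem preserved_iff_toSection (hW : IsCofibrationClass W) (sq : IsPullback r p p' χ)
    (j : UniformFibration I p) (j' : UniformFibration I p') :
    j.Preserved I j' r χ ↔ j.localFilling.toSection ≫ fillMap I sq =
      (ihom I.obj).map χ ≫ j'.localFilling.toSection := by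
  rw [preserved_iff_local hW sq.w]
  constructor
  · intro H
    ext c x
    refine FillElt.ext' I rfl fun {d} f k φ v a h₁ h₂ => ?_
    have hl := h₁.congr I (path_push I χ f x)
    refine (H k _ φ _ _ (isFillProblem_lift I sq hl)).symm.trans ?_
    exact j'.localFilling.fill_congr (path_push I χ f x).symm (liftV_fst I sq hl)
      (liftA_fst I sq hl) _ _
  · intro H d k y φ v a h
    have e : FillElt.push I sq (j.localFilling.fillElt (pathElt I y)) =
        j'.localFilling.fillElt (((ihom I.obj).map χ).app (op d) (pathElt I y)) :=
      ConcreteCategory.congr_hom (NatTrans.congr_app H (op d)) (pathElt I y)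
    have ey : y = I.obj ◁ yoneda.map (𝟙 d) ≫ pathMap I (pathElt I y) := by
      rw [pathMap_pathElt]; simp
    have ey' : y ≫ χ = I.obj ◁ yoneda.map (𝟙 d) ≫
        pathMap I (((ihom I.obj).map χ).app (op d) (pathElt I y)) := by
      rw [path_push, ← ey]
    have e' := FillElt.fill_eq_of_eq e (𝟙 d) k φ (v ≫ r) (a ≫ r)
      ((h.comp I sq.w).congr I ey') ((h.comp I sq.w).congr I ey')
    refine Eq.trans (j'.localFilling.fill_congr ey' rfl rfl _ _)
      (e'.symm.trans (congrArg (· ≫ r) (j.localFilling.fill_congr ey.symm ?_ ?_ _ _)))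
    · apply sq.hom_ext
      · exact liftV_fst I sq _
      · refine (liftV_snd I sq _).trans (Eq.trans ?_ h.v_over.symm)
        exact congrArg (_ ≫ ·) ey.symm
    · apply sq.hom_ext
      · exact liftA_fst I sq _
      · refine (liftA_snd I sq _).trans (Eq.trans ?_ h.a_over.symm)
        exact congrArg (_ ≫ ·) ey.symm

end Preserved

end Sections

/-! ### The classifying object of fibration structures -/

section Root

variable {C : Type u} [SmallCategory.{u} C] {W : MorphismProperty (Psh C)} (I : Interval W)
  {R : Psh C ⥤ Psh C} (adj : ihom I.obj ⊣ R)

/-- The projection of `Fib*(α)` to the root of the object of filling structures. -/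
noncomputable def fibStarSnd {A X : Psh C} (p : A ⟶ X) :
    fibStarObj I adj p ⟶ R.obj (fillObj I p) :=
  pullback.snd _ _

theorem isPullback_fibStar {A X : Psh C} (p : A ⟶ X) :
    IsPullback (fibStarSnd I adj p) (fibStarProj I adj p) (R.map (fillProj I p))
      (adj.unit.app X) :=
  (IsPullback.of_hasPullback _ _).flip

/-- Stability of `Fib*` under pullback: the root functor is a right adjoint, so it preserves the
stability of filling structures. -/
theorem isPullback_fibStarMap {A X B Y : Psh C} {p : A ⟶ X} {p' : B ⟶ Y} {q : B ⟶ A} {t : Y ⟶ X}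
    (sq : IsPullback q p' p t) :
    IsPullback (fibStarMap I adj sq) (fibStarProj I adj p') (fibStarProj I adj p) t := by
  have : PreservesLimitsOfSize.{0, 0} R := adj.rightAdjoint_preservesLimits
  have hR : IsPullback (R.map (fillMap I sq)) (R.map (fillProj I p')) (R.map (fillProj I p))
      (R.map ((ihom I.obj).map t)) := (isPullback_fillMap sq).map R
  refine IsPullback.of_right ?_ (pullback.lift_fst _ _ _) (isPullback_fibStar I adj p)
  have e₁ : fibStarMap I adj sq ≫ fibStarSnd I adj p =
      fibStarSnd I adj p' ≫ R.map (fillMap I sq) := pullback.lift_snd _ _ _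
  have e₂ : t ≫ adj.unit.app X = adj.unit.app Y ≫ R.map ((ihom I.obj).map t) :=
    adj.unit.naturality t
  rw [e₁, e₂]
  exact (isPullback_fibStar I adj p').paste_horiz hR

/-- The transpose `Y^I ⟶ Fill(α ∘ x)` of a map `Y ⟶ Fib*(α)` along the adjunction between the path
functor and the root functor. -/
noncomputable def fibStarTranspose {A X Y : Psh C} {p : A ⟶ X} (χ : Y ⟶ fibStarObj I adj p) :
    pathObj I Y ⟶ fillObj I p :=
  (adj.homEquiv _ _).symm (χ ≫ fibStarSnd I adj p)

variable {I}

theorem fibStarTranspose_fillProj {A X Y : Psh C} {p : A ⟶ X} (χ : Y ⟶ fibStarObj I adj p) :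
    fibStarTranspose I adj χ ≫ fillProj I p = (ihom I.obj).map (χ ≫ fibStarProj I adj p) := by
  rw [fibStarTranspose, ← adj.homEquiv_naturality_right_symm, Equiv.symm_apply_eq,
    adj.homEquiv_unit, Category.assoc, (isPullback_fibStar I adj p).w, ← Category.assoc]
  exact adj.unit.naturality _

theorem fibStarTranspose_comp {A X Y Z : Psh C} {p : A ⟶ X} (s : Z ⟶ Y)
    (χ : Y ⟶ fibStarObj I adj p) :
    fibStarTranspose I adj (s ≫ χ) = (ihom I.obj).map s ≫ fibStarTranspose I adj χ := by
  rw [fibStarTranspose, Category.assoc, adj.homEquiv_naturality_left_symm, fibStarTranspose]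

theorem fibStarTranspose_ext {A X Y : Psh C} {p : A ⟶ X} {χ χ' : Y ⟶ fibStarObj I adj p}
    (h : χ ≫ fibStarProj I adj p = χ' ≫ fibStarProj I adj p)
    (h' : fibStarTranspose I adj χ = fibStarTranspose I adj χ') : χ = χ' :=
  (isPullback_fibStar I adj p).hom_ext ((adj.homEquiv _ _).symm.injective h') h

/-- Every map `Y^I ⟶ Fill(p)` over `t^I` is the transpose of a map `Y ⟶ Fib*(p)` over `t`. -/
theorem exists_fibStarTranspose_eq {A X Y : Psh C} {p : A ⟶ X} (t : Y ⟶ X)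
    (τ : pathObj I Y ⟶ fillObj I p) (h : τ ≫ fillProj I p = (ihom I.obj).map t) :
    ∃ χ : Y ⟶ fibStarObj I adj p, χ ≫ fibStarProj I adj p = t ∧
      fibStarTranspose I adj χ = τ := by
  have w : adj.homEquiv _ _ τ ≫ R.map (fillProj I p) = t ≫ adj.unit.app X := by
    rw [← adj.homEquiv_naturality_right, h, adj.homEquiv_unit]
    exact (adj.unit.naturality t).symm
  have H := isPullback_fibStar I adj p
  refine ⟨H.lift _ _ w, H.lift_snd _ _ w, ?_⟩
  rw [fibStarTranspose, Equiv.symm_apply_eq, H.lift_fst]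

/-- The object `Fib*(p)` classifies uniform fibration structures on pullbacks of `p`: the pullback
of `p` to `Fib*(p)` carries a generic structure, from which every structure on a pullback of `p`
along `α` is pulled back along exactly one lift of `α`. -/
theorem exists_generic_uniformFibration (hW : IsCofibrationClass W) {A X B : Psh C} {p : A ⟶ X}
    {p' : B ⟶ fibStarObj I adj p} {κ : B ⟶ A} (sqκ : IsPullback κ p' p (fibStarProj I adj p)) :
    ∃ j' : UniformFibration I p', ∀ {D Z : Psh C} {p'' : D ⟶ Z} (j : UniformFibration I p'')
      {q : D ⟶ A} {α : Z ⟶ X}, IsPullback q p'' p α →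
      ∃! χ : Z ⟶ fibStarObj I adj p, χ ≫ fibStarProj I adj p = α ∧
        ∃ r : D ⟶ B, r ≫ κ = q ∧ IsPullback r p'' p' χ ∧ j.Preserved I j' r χ := by
  have Hκ := isPullback_fillMap (I := I) sqκ
  -- The generic structure corresponds to the identity of `Fib*(p)`.
  have w : fibStarTranspose I adj (𝟙 (fibStarObj I adj p)) ≫ fillProj I p =
      𝟙 _ ≫ (ihom I.obj).map (fibStarProj I adj p) := by
    rw [fibStarTranspose_fillProj, Category.id_comp, Category.id_comp]
  obtain ⟨j', hj'⟩ := exists_uniformFibration_toSection_eq hW (Hκ.lift_snd _ _ w)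
  -- A structure is pulled back from the generic one along `χ` exactly if its section corresponds
  -- to the transpose of `χ`.
  have key {D Z : Psh C} {p'' : D ⟶ Z} (j : UniformFibration I p'') {r : D ⟶ B}
      {χ : Z ⟶ fibStarObj I adj p} (sqr : IsPullback r p'' p' χ) :
      j.Preserved I j' r χ ↔ j.localFilling.toSection ≫ fillMap I (sqr.paste_horiz sqκ) =
        fibStarTranspose I adj χ := by
    have e : fibStarTranspose I adj χ =
        ((ihom I.obj).map χ ≫ j'.localFilling.toSection) ≫ fillMap I sqκ := by
      rw [Category.assoc, hj', Hκ.lift_fst, ← fibStarTranspose_comp, Category.comp_id]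
    rw [preserved_iff_toSection hW sqr, ← fillMap_comp sqκ sqr, e, ← Category.assoc]
    refine ⟨fun h => by rw [h], fun h => Hκ.hom_ext h ?_⟩
    rw [Category.assoc, fillMap_fillProj, Category.assoc, LocalFilling.toSection_fillProj,
      ← Category.assoc, LocalFilling.toSection_fillProj, Category.id_comp, Category.comp_id]
  refine ⟨j', fun {D Z p''} j {q α} sq => ?_⟩
  obtain ⟨χ, rfl, hχ⟩ := exists_fibStarTranspose_eq adj α (j.localFilling.toSection ≫ fillMap I sq)
    (by rw [Category.assoc, fillMap_fillProj, ← Category.assoc, LocalFilling.toSection_fillProj,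
      Category.id_comp])
  have w' : q ≫ p = (p'' ≫ χ) ≫ fibStarProj I adj p := by rw [sq.w, Category.assoc]
  have sqr : IsPullback (sqκ.lift q (p'' ≫ χ) w') p'' p' χ :=
    IsPullback.of_right (by rw [sqκ.lift_fst]; exact sq) (sqκ.lift_snd _ _ _) sqκ
  refine ⟨χ, ⟨rfl, _, sqκ.lift_fst _ _ w', sqr, (key j sqr).2 ?_⟩, ?_⟩
  · rw [hχ]
    congr 2
    exact sqκ.lift_fst _ _ w'
  · rintro χ' ⟨hα, r, rfl, sqr', hj⟩
    refine fibStarTranspose_ext adj hα (((key j sqr').1 hj).symm.trans (Eq.trans ?_ hχ.symm))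
    congr 2

end Root

/-! ### The classifier of small maps -/

section Universe

variable {C : Type (max v (w + 1))} [SmallCategory.{max v (w + 1)} C]

theorem IsSmallMap.of_isPullback {C : Type u} [SmallCategory.{u} C] {A X B Y : Psh C} {p : A ⟶ X}
    {p' : B ⟶ Y} {q : A ⟶ B} {t : X ⟶ Y} (sq : IsPullback q p p' t) (h : IsSmallMap.{w} p') :
    IsSmallMap.{w} p := by
  intro c x
  have := h c (t.app (op c) x)
  have e (a : A.obj (op c)) : p'.app (op c) (q.app (op c) a) = t.app (op c) (p.app (op c) a) :=
    ConcreteCategory.congr_hom (NatTrans.congr_app sq.w (op c)) a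
  refine small_of_injective (β := {b : B.obj (op c) // p'.app (op c) b = t.app (op c) x})
    (f := fun a => ⟨q.app (op c) a.1, by rw [e, a.2]⟩) fun a b hab => Subtype.ext ?_
  exact Types.ext_of_isPullback (sq.app (op c)) (congrArg Subtype.val hab) (a.2.trans b.2.symm)

/-- The points of a pointed presheaf are determined by the point at a terminal object, since
restriction preserves them. -/
theorem PointedPsh.ext_of_terminal {D : Type u} [Category.{u} D] {β β' : PointedPsh.{w, u} D}
    {d : D} (hd : IsTerminal d) (h : β.psh = β'.psh)
    (h' : cast (congrArg (fun P : Dᵒᵖ ⥤ Type w => P.obj (op d)) h) (β.point (op d)) =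
      β'.point (op d)) : β = β' := by
  obtain ⟨P, x, hx⟩ := β
  obtain ⟨P', x', hx'⟩ := β'
  obtain rfl : P = P' := h
  obtain rfl : x = x' := by
    funext e
    rw [← hx (hd.from e.unop).op, ← hx' (hd.from e.unop).op]
    exact congrArg _ h'
  rfl

/-- The fibre of `π` over a presheaf `P` on `C/c` injects into the small set `P(id)`. -/
theorem isSmallMap_univProj : IsSmallMap.{w} (univProj.{w, v} C) := by
  intro c P
  let f : {β : (Ptd.{w, v} C).obj (op c) // (univProj.{w, v} C).app (op c) β = P} →
      Functor.obj (C := (Over c)ᵒᵖ) (D := Type w) P (op (Over.mk (𝟙 c))) := fun β =>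
    cast (congrArg (fun P : (Over c)ᵒᵖ ⥤ Type w => P.obj (op (Over.mk (𝟙 c)))) β.2)
      (PointedPsh.point β.1 (op (Over.mk (𝟙 c))))
  refine small_of_injective (f := f) ?_
  rintro ⟨β, rfl⟩ ⟨β', h'⟩ e
  refine Subtype.ext (PointedPsh.ext_of_terminal Over.mkIdTerminal h'.symm ?_)
  have e' : PointedPsh.point β (op (Over.mk (𝟙 c))) = cast _ (PointedPsh.point β' _) := e
  exact (congrArg _ e').trans ((cast_cast _ _ _).trans (cast_eq _ _))

theorem liftsPtd_injective {C : Type u} [SmallCategory.{u} C] {A X : Psh C} {p : A ⟶ X}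
    {hp : IsSmallMap.{w} p} {c : C} {z : ∀ f : Over c, X.obj (op f.left)} {hz}
    {s s' : ∀ f : Over c, A.obj (op f.left)} {hs hs' hsz hsz'}
    (h : liftsPtd p hp z hz s hs hsz = liftsPtd p hp z hz s' hs' hsz') : s = s' := by
  have (f : Over c) : Small.{w} {a : A.obj (op f.left) // p.app (op f.left) a = z f} :=
    hp f.left (z f)
  unfold liftsPtd at h
  have h' := eq_of_heq (PointedPsh.mk.inj h).2
  funext f
  exact congrArg Subtype.val ((equivShrink _).injective (congrFun h' (op f)))

theorem exists_liftsPtd_eq {C : Type u} [SmallCategory.{u} C] {A X : Psh C} {p : A ⟶ X}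
    (hp : IsSmallMap.{w} p) {c : C} (x : X.obj (op c)) (β : PointedPsh.{w, u} (Over c))
    (h : β.psh = liftsPsh p hp (restrictions x) (restrictions_map x)) :
    ∃ a : A.obj (op c), liftsPtd p hp (restrictions (p.app (op c) a)) (restrictions_map _)
      (restrictions a) (restrictions_map a) (restrictions_app p a) = β ∧ p.app (op c) a = x := by
  obtain ⟨P, pt, hpt⟩ := β
  obtain rfl : P = _ := h
  have (f : Over c) :
      Small.{w} {a : A.obj (op f.left) // p.app (op f.left) a = restrictions x f} :=
    hp f.left (restrictions x f)
  obtain ⟨⟨(a : A.obj (op c)), ha⟩, hpa⟩ :=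
    (equivShrink _).surjective (pt (op (Over.mk (𝟙 c))))
  have hx : p.app (op c) a = x := ha.trans (by simp [restrictions])
  refine ⟨a, ?_, hx⟩
  rw [liftsPtd_congr p hp (congrArg restrictions hx) (restrictions_map _) (restrictions_map x)
    (rfl : restrictions a = _) (restrictions_map a) (restrictions_map a) (restrictions_app p a)
    (fun f => (restrictions_app p a f).trans (congrFun (congrArg restrictions hx) f))]
  refine PointedPsh.ext_of_terminal Over.mkIdTerminal rfl ?_
  refine Eq.trans ?_ hpa
  refine congrArg (equivShrink _) (Subtype.ext ?_)
  change A.map (𝟙 c).op a = a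
  simp

/-- Every small map is the pullback of `π` along its characteristic map: a point of the presheaf of
lifts of `x` is determined by its value at the identity, which is a lift of `x`. -/
theorem isPullback_charLift {A X : Psh C} (p : A ⟶ X) (hp : IsSmallMap.{w} p) :
    IsPullback (charLift.{w, v} p hp) p (univProj.{w, v} C) (charMap.{w, v} p hp) := by
  refine isPullback_of_existsUnique rfl fun c β x h => ?_
  obtain ⟨a, ha, hx⟩ := exists_liftsPtd_eq hp (c := c.unop) x β h
  refine ⟨a, ⟨ha, hx⟩, fun b ⟨hb, hb'⟩ => ?_⟩
  subst hx
  have hba : liftsPtd p hp (restrictions (p.app c b)) (restrictions_map _)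
      (restrictions b) (restrictions_map b) (restrictions_app p b) = β := hb
  rw [liftsPtd_congr p hp (congrArg restrictions hb') (restrictions_map _) (restrictions_map _)
    (rfl : restrictions b = _) (restrictions_map b) (restrictions_map b) (restrictions_app p b)
    (fun f => (restrictions_app p b f).trans (by rw [hb'])), ← ha] at hba
  have e := congrFun (liftsPtd_injective hba) (Over.mk (𝟙 c.unop))
  change A.map (𝟙 c.unop).op b = A.map (𝟙 c.unop).op a at e
  simpa using e

/-- The projection of the comprehension of a family to the object of pointed types. -/
noncomputable def comprSnd {X : Psh C} (α : X ⟶ Univ.{w, v} C) : compr α ⟶ Ptd.{w, v} C :=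
  pullback.snd _ _

theorem isPullback_compr {X : Psh C} (α : X ⟶ Univ.{w, v} C) :
    IsPullback (comprSnd α) (disp α) (univProj.{w, v} C) α :=
  (IsPullback.of_hasPullback _ _).flip

/-- A pullback of `π : E ⟶ U` is a pullback of the display map of the generic family. -/
theorem exists_isPullback_disp_id {A X : Psh C} {p : A ⟶ X} {α : X ⟶ Univ.{w, v} C}
    {q : A ⟶ Ptd.{w, v} C} (sq : IsPullback q p (univProj.{w, v} C) α) :
    ∃ q' : A ⟶ compr (𝟙 (Univ.{w, v} C)), q' ≫ comprSnd _ = q ∧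
      IsPullback q' p (disp (𝟙 (Univ.{w, v} C))) α := by
  have H := isPullback_compr (𝟙 (Univ.{w, v} C))
  have w' : q ≫ univProj.{w, v} C = (p ≫ α) ≫ 𝟙 _ := by rw [sq.w, Category.comp_id]
  refine ⟨H.lift q (p ≫ α) w', H.lift_fst _ _ _, IsPullback.of_right ?_ (H.lift_snd _ _ _) H⟩
  rw [H.lift_fst, Category.comp_id]
  exact sq

/-- The comprehension of the generic family is isomorphic to `E`. -/
theorem mono_comprSnd_id : Mono (comprSnd (𝟙 (Univ.{w, v} C))) := by
  have H := isPullback_compr (𝟙 (Univ.{w, v} C))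
  have := H.isIso_fst_of_isIso
  infer_instance

end Universe

end PshFib

theorem mainTheorem11 {C : Type (max v (w + 1))} [SmallCategory.{max v (w + 1)} C]
    (W : MorphismProperty (Psh C)) (hW : IsCofibrationClass W) (I : PshFib.Interval W)
    {R : Psh C ⥤ Psh C} (adj : ihom I.obj ⊣ R) :
    -- `Fib*(α)` is stable under pullback
    (∀ {X Y : Psh C} (α : X ⟶ Univ.{w, v} C) (β : Y ⟶ Univ.{w, v} C)
      (q : compr.{w, v} β ⟶ compr.{w, v} α) (t : Y ⟶ X)
      (sq : IsPullback q (disp.{w, v} β) (disp.{w, v} α) t),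
      IsPullback (fibStarMap I adj sq) (fibStarProj I adj (disp.{w, v} β))
        (fibStarProj I adj (disp.{w, v} α)) t) ∧
    -- the universal fibration is a small map with a uniform fibration structure
    IsSmallMap.{w} (univFib.{w, v} I adj) ∧
    ∃ jᵤ : UniformFibration I (univFib.{w, v} I adj),
      ∀ {A X : Psh C} (p : A ⟶ X) (hp : IsSmallMap.{w} p) (j : UniformFibration I p),
        IsPullback (charLift.{w, v} p hp) p (univProj.{w, v} C) (charMap.{w, v} p hp) ∧
        ∀ (α : X ⟶ Univ.{w, v} C) (q : A ⟶ Ptd.{w, v} C),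
          IsPullback q p (univProj.{w, v} C) α →
          ∃! χ : X ⟶ Fib.{w, v} I adj, χ ≫ fibToUniv.{w, v} I adj = α ∧
            ∃ r : A ⟶ FibPtd.{w, v} I adj, r ≫ fibPtdToPtd.{w, v} I adj = q ∧
              IsPullback r p (univFib.{w, v} I adj) χ ∧ j.Preserved I jᵤ r χ := by
  refine ⟨fun α β q t sq => isPullback_fibStarMap I adj sq, ?_, ?_⟩
  · exact IsSmallMap.of_isPullback (IsPullback.of_hasPullback _ _).flip isSmallMap_univProj
  have sqπ : IsPullback (fibPtdToPtd.{w, v} I adj) (univFib.{w, v} I adj) (univProj.{w, v} C)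
      (fibToUniv.{w, v} I adj) := (IsPullback.of_hasPullback _ _).flip
  obtain ⟨κ, hκ, sqκ⟩ := exists_isPullback_disp_id sqπ
  obtain ⟨jᵤ, hjᵤ⟩ := exists_generic_uniformFibration adj hW sqκ
  refine ⟨jᵤ, fun p hp j => ⟨isPullback_charLift p hp, fun α q sq => ?_⟩⟩
  obtain ⟨q', rfl, sq'⟩ := exists_isPullback_disp_id sq
  have (r : _ ⟶ FibPtd.{w, v} I adj) :
      r ≫ fibPtdToPtd.{w, v} I adj = q' ≫ comprSnd _ ↔ r ≫ κ = q' := by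
    have := mono_comprSnd_id.{w, v} (C := C)
    rw [← hκ, ← Category.assoc, cancel_mono]
  simp only [this]
  exact hjᵤ j sq'
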